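/- Let $1\le p<\infty$. Let $A=\lambda\otimes\lambda\otimes\cdots$ be the infinite product, over the primes, of the normalized Lebesgue measure $\lambda$ on the unit disk $\mathbb D$. For a Dirichlet polynomial $P(s)=\sum_{n\le N}a_nn^{-s}$ put $D(P)(z)=\sum_{n\le N}a_n\prod_{q\mid n}z_q^{\alpha_q(n)}$, where $n=\prod_{q\mid n}q^{\alpha_q(n)}$ is the prime factorization, and $\|P\|_{\mathcal B^p}=\big(\int_{\mathbb D^\infty}|D(P)|^p\,dA\big)^{1/p}$. Let $\mathcal B^p$ be the completion of the space of Dirichlet polynomials for this norm. For each $n\ge1$ the coefficient $P\mapsto a_n$ is bounded for this norm and so extends continuously to $f\mapsto a_n(f)$ on $\mathcal B^p$; the Dirichlet series of $f\in\mathcal B^p$ is $\sum_{n\ge1}a_n(f)n^{-s}$. For a Dirichlet series, $\sigma_u$ is the infimum of the real $a$ such that the series converges uniformly on $\{\Re s>a\}$, and, if the series converges on some half-plane, $\sigma_b$ is the infimum of the real $a$ such that its sum has a bounded analytic extension to $\{\Re s>a\}$. Then: (i) For every $f\in\mathcal B^p$, the Dirichlet series of $f$ satisfies $\sigma_u(f)\le\frac12$.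 (ii) If $\Re w>\frac12$, then for every $f\in\mathcal B^p$ the Dirichlet series of $f$ converges at $w$, and its sum $f(w)$ satisfies $$|f(w)|\le\zeta(2\Re w)^{2/p}\,\|f\|_{\mathcal B^p}.$$ Moreover the evaluation $\delta_w:f\mapsto f(w)$ is a bounded linear functional on $\mathcal B^p$ of norm exactly $$\|\delta_w\|=\zeta(2\Re w)^{2/p}.$$ (iii) There exists $f\in\mathcal B^p$ with $\sigma_b(f)=\frac12$. -/

import Mathlib

open MeasureTheory Filter Topology UniformSpace
open scoped ENNReal

noncomputable section

namespace DirichletBergman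

/-! ### The measure on the infinite polydisk -/

/-- Normalized Lebesgue measure on the open unit disk, as a measure on `ℂ` carried by the disk. -/
def diskMeasure : Measure ℂ :=
  (volume (Metric.ball (0 : ℂ) 1))⁻¹ • volume.restrict (Metric.ball (0 : ℂ) 1)

instance : IsProbabilityMeasure diskMeasure := by
  refine ⟨?_⟩
  simp only [diskMeasure, Measure.smul_apply, Measure.restrict_apply MeasurableSet.univ,
    Set.univ_inter, smul_eq_mul]
  exact ENNReal.inv_mul_cancel (Metric.measure_ball_pos volume _ one_pos).ne'
    measure_ball_lt_top.ne

/-- The product measure `A = λ ⊗ λ ⊗ ⋯` on the infinite polydisk. The coordinates are indexed by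
the primes: `z q` is the variable that corresponds to `q ^ (-s)`. -/
def polydiskMeasure : Measure (Nat.Primes → ℂ) :=
  Measure.infinitePi fun _ => diskMeasure

instance : IsProbabilityMeasure polydiskMeasure := by
  unfold polydiskMeasure; infer_instance

/-- The prime divisors of `n`. -/
def primeSupport (n : ℕ+) : Finset Nat.Primes := (n : ℕ).primeFactors.subtype Nat.Prime

/-- The monomial `z ^ (n) = ∏ z_q ^ (α_q)`, where `n = ∏ q ^ (α_q)` is the prime factorization. -/
def monomial (n : ℕ+) (z : Nat.Primes → ℂ) : ℂ :=
  ∏ q ∈ primeSupport n, z q ^ (n : ℕ).factorization q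

lemma measurable_monomial (n : ℕ+) : Measurable (monomial n) := by
  unfold monomial
  fun_prop

lemma ae_mem_disk : ∀ᵐ x ∂diskMeasure, ‖x‖ < 1 := by
  refine Measure.ae_smul_measure ?_ _
  filter_upwards [ae_restrict_mem measurableSet_ball] with x hx
  simpa using hx

lemma ae_ne_zero : ∀ᵐ x ∂diskMeasure, x ≠ 0 := by
  refine Measure.ae_smul_measure ?_ _
  exact ae_restrict_of_ae (Measure.ae_ne volume 0)

lemma ae_polydisk {P : ℂ → Prop} (hP : ∀ᵐ x ∂diskMeasure, P x) :
    ∀ᵐ z ∂polydiskMeasure, ∀ q, P (z q) := by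
  rw [ae_all_iff]
  intro q
  exact (measurePreserving_eval_infinitePi (fun _ : Nat.Primes => diskMeasure)
    q).quasiMeasurePreserving.ae hP

lemma norm_monomial_le (n : ℕ+) : ∀ᵐ z ∂polydiskMeasure, ‖monomial n z‖ ≤ 1 := by
  filter_upwards [ae_polydisk ae_mem_disk] with z hz
  rw [monomial, norm_prod]
  refine Finset.prod_le_one (fun _ _ => norm_nonneg _) fun q _ => ?_
  rw [norm_pow]
  exact pow_le_one₀ (norm_nonneg _) (hz q).le

lemma memLp_monomial (p : ℝ≥0∞) (n : ℕ+) : MemLp (monomial n) p polydiskMeasure :=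
  MemLp.of_bound (measurable_monomial n).aestronglyMeasurable 1 (norm_monomial_le n)

/-! ### Dirichlet polynomials and the Bergman norm -/

variable (p : ℝ≥0∞)

/-- Dirichlet polynomials `∑ a_n n ^ (-s)`, given by their finitely supported coefficients and
normed by the parameter `p`. -/
def DirichletPoly (_p : ℝ≥0∞) : Type := ℕ+ →₀ ℂ

instance : AddCommGroup (DirichletPoly p) := inferInstanceAs (AddCommGroup (ℕ+ →₀ ℂ))

instance : Module ℂ (DirichletPoly p) := inferInstanceAs (Module ℂ (ℕ+ →₀ ℂ))

/-- The coefficients of a Dirichlet polynomial. -/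
def DirichletPoly.toFinsupp : DirichletPoly p ≃ₗ[ℂ] (ℕ+ →₀ ℂ) := LinearEquiv.refl ℂ (ℕ+ →₀ ℂ)

/-- The `n`-th coefficient of a Dirichlet polynomial. -/
def polyCoeff (n : ℕ+) : DirichletPoly p →ₗ[ℂ] ℂ :=
  Finsupp.lapply n ∘ₗ (DirichletPoly.toFinsupp p).toLinearMap

/-- The Bohr lift `D(∑ a_n n ^ (-s)) = ∑ a_n z ^ (n)`, as an element of `L ^ p` of the infinite
polydisk. -/
def bohrLift : DirichletPoly p →ₗ[ℂ] Lp ℂ p polydiskMeasure :=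
  (Finsupp.linearCombination ℂ fun n => (memLp_monomial p n).toLp (monomial n)) ∘ₗ
    (DirichletPoly.toFinsupp p).toLinearMap

/-! ### The coefficients are bounded by the norm -/

lemma bohrLift_coe (P : DirichletPoly p) :
    (bohrLift p P : (Nat.Primes → ℂ) → ℂ) =ᵐ[polydiskMeasure]
      fun z => ∑ n ∈ (DirichletPoly.toFinsupp p P).support, polyCoeff p n P * monomial n z := by
  have h0 : bohrLift p P = ∑ n ∈ (DirichletPoly.toFinsupp p P).support,
      polyCoeff p n P • (memLp_monomial p n).toLp (monomial n) := by
    simp [bohrLift, polyCoeff, Finsupp.linearCombination_apply, Finsupp.sum]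
  rw [h0]
  refine (Lp.coeFn_finsetSum _ _).trans ?_
  have : ∀ᵐ z ∂polydiskMeasure, ∀ n : ℕ+,
      ((polyCoeff p n P • (memLp_monomial p n).toLp (monomial n) :
        Lp ℂ p polydiskMeasure) : (Nat.Primes → ℂ) → ℂ) z = polyCoeff p n P * monomial n z := by
    rw [ae_all_iff]
    intro n
    filter_upwards [Lp.coeFn_smul (polyCoeff p n P)
      ((memLp_monomial p n).toLp (monomial n)), (memLp_monomial p n).coeFn_toLp] with z h1 h2
    rw [h1, Pi.smul_apply, h2, smul_eq_mul]
  filter_upwards [this] with z hz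
  simp only [Finset.sum_apply]
  exact Finset.sum_congr rfl fun n _ => hz n

lemma diskMeasure_rotate (u : ℂ) (hu : ‖u‖ = 1) :
    diskMeasure.map (fun x => u * x) = diskMeasure := by
  have h1 : MeasurePreserving (fun x : ℂ => u * x) volume volume :=
    (rotation ⟨u, by simpa [Submonoid.unitSphere] using hu⟩).measurePreserving
  have h2 := h1.restrict_preimage (s := Metric.ball (0 : ℂ) 1) measurableSet_ball
  have h3 : (fun x : ℂ => u * x) ⁻¹' Metric.ball 0 1 = Metric.ball 0 1 := by
    ext x; simp [hu]
  rw [h3] at h2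
  rw [diskMeasure, Measure.map_smul, h2.map_eq]

lemma integral_rotate (u : Nat.Primes → ℂ) (hu : ∀ q, ‖u q‖ = 1) (F : (Nat.Primes → ℂ) → ℂ)
    (hF : AEStronglyMeasurable F polydiskMeasure) :
    ∫ z, F (fun q => u q * z q) ∂polydiskMeasure = ∫ z, F z ∂polydiskMeasure := by
  have h : polydiskMeasure.map (fun z q => u q * z q) = polydiskMeasure := by
    have := Measure.infinitePi_map_pi (fun _ : Nat.Primes => diskMeasure)
      (f := fun q x => u q * x) (fun q => by fun_prop)
    simp only [diskMeasure_rotate _ (hu _)] at this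
    exact this
  conv_rhs => rw [← h]
  have hm : Measurable fun (z : Nat.Primes → ℂ) q => u q * z q :=
    measurable_pi_lambda _ fun q => measurable_const.mul (measurable_pi_apply q)
  rw [integral_map hm.aemeasurable (by rwa [h])]

lemma monomial_mul (n : ℕ+) (u z : Nat.Primes → ℂ) :
    monomial n (fun q => u q * z q) = monomial n u * monomial n z := by
  simp [monomial, mul_pow, Finset.prod_mul_distrib]

lemma monomial_update (n : ℕ+) (q : Nat.Primes) (v : ℂ) :
    monomial n (Function.update 1 q v) = v ^ (n : ℕ).factorization q := by
  rw [monomial, Finset.prod_eq_single q]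
  · simp
  · intro r _ hr
    simp [Function.update_of_ne hr]
  · intro hq
    have hq' : (n : ℕ).factorization q = 0 := by
      rw [← Finsupp.notMem_support_iff, Nat.support_factorization]
      intro h
      exact hq (Finset.mem_subtype.2 h)
    simp [hq']

lemma exists_monomial_mul_ne {m n : ℕ+} (h : m ≠ n) : ∃ u : Nat.Primes → ℂ,
    (∀ q, ‖u q‖ = 1) ∧ monomial m u * star (monomial n u) ≠ 1 := by
  obtain ⟨q, hq⟩ : ∃ q : Nat.Primes, (m : ℕ).factorization q ≠ (n : ℕ).factorization q := by
    by_contra! H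
    refine h (PNat.eq (Nat.eq_of_factorization_eq m.ne_zero n.ne_zero fun q => ?_))
    by_cases hq : q.Prime
    · exact H ⟨q, hq⟩
    · simp [Nat.factorization_eq_zero_of_not_prime _ hq]
  set a := (m : ℕ).factorization q
  set b := (n : ℕ).factorization q
  have hab : ((a : ℂ) - b) ≠ 0 := sub_ne_zero.2 (by exact_mod_cast hq)
  set t : ℝ := Real.pi / ((a : ℝ) - b)
  have ht : ‖Complex.exp (t * Complex.I)‖ = 1 := Complex.norm_exp_ofReal_mul_I t
  refine ⟨Function.update 1 q (Complex.exp (t * Complex.I)), fun r => ?_, ?_⟩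
  · by_cases hr : r = q
    · subst hr; simp [ht]
    · simp [Function.update_of_ne hr]
  · rw [monomial_update, monomial_update]
    have : Complex.exp (t * Complex.I) ^ a * star (Complex.exp (t * Complex.I) ^ b) = -1 := by
      rw [← Complex.exp_pi_mul_I, star_pow, Complex.star_def, ← Complex.exp_conj,
        ← Complex.exp_nat_mul, ← Complex.exp_nat_mul, ← Complex.exp_add]
      congr 1
      simp only [map_mul, Complex.conj_ofReal, Complex.conj_I, t]
      push_cast
      field_simp
      ring
    change Complex.exp (t * Complex.I) ^ a * star (Complex.exp (t * Complex.I) ^ b) ≠ 1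
    rw [this]
    norm_num

lemma measurable_monomial_mul_star (m n : ℕ+) :
    Measurable fun z => monomial m z * star (monomial n z) :=
  (measurable_monomial m).mul (continuous_star.measurable.comp (measurable_monomial n))

lemma integral_monomial_mul_of_ne {m n : ℕ+} (h : m ≠ n) :
    ∫ z, monomial m z * star (monomial n z) ∂polydiskMeasure = 0 := by
  obtain ⟨u, hu, hne⟩ := exists_monomial_mul_ne h
  have h1 := integral_rotate u hu (fun z => monomial m z * star (monomial n z))
    (measurable_monomial_mul_star m n).aestronglyMeasurable
  have h2 : ∀ z : Nat.Primes → ℂ,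
      monomial m (fun q => u q * z q) * star (monomial n (fun q => u q * z q))
        = monomial m u * star (monomial n u) * (monomial m z * star (monomial n z)) := by
    intro z
    rw [monomial_mul, monomial_mul, star_mul']
    ring
  simp only [h2] at h1
  rw [integral_const_mul] at h1
  by_contra h0
  exact hne (mul_right_cancel₀ h0 (h1.trans (one_mul _).symm))

/-- The squared `L ^ 2` norm of a monomial. -/
def monomialSq (n : ℕ+) : ℝ := ∫ z, ‖monomial n z‖ ^ 2 ∂polydiskMeasure

lemma integrable_monomialSq (n : ℕ+) :
    Integrable (fun z => ‖monomial n z‖ ^ 2) polydiskMeasure :=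
  (memLp_monomial 2 n).integrable_norm_pow (by norm_num)

lemma monomialSq_pos (n : ℕ+) : 0 < monomialSq n := by
  rw [monomialSq, integral_pos_iff_support_of_nonneg (fun _ => by positivity)
    (integrable_monomialSq n)]
  have h : ∀ᵐ z ∂polydiskMeasure, z ∈ Function.support fun z => ‖monomial n z‖ ^ 2 := by
    filter_upwards [ae_polydisk ae_ne_zero] with z hz
    simp only [Function.mem_support]
    have : monomial n z ≠ 0 := Finset.prod_ne_zero_iff.2 fun q _ => pow_ne_zero _ (hz q)
    positivity
  rw [measure_congr (eventuallyEq_univ.2 h : Function.support _ =ᵐ[polydiskMeasure] Set.univ)]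
  simp

lemma integral_bohrLift_mul (n : ℕ+) (P : DirichletPoly p) :
    ∫ z, (bohrLift p P : (Nat.Primes → ℂ) → ℂ) z * star (monomial n z) ∂polydiskMeasure
      = polyCoeff p n P * monomialSq n := by
  have hint : ∀ m : ℕ+, Integrable
      (fun z => polyCoeff p m P * (monomial m z * star (monomial n z)))
      polydiskMeasure := by
    intro m
    refine Integrable.const_mul ?_ _
    exact (memLp_monomial 2 m).integrable_mul (memLp_monomial 2 n).star
  have h1 : ∫ z, (bohrLift p P : (Nat.Primes → ℂ) → ℂ) z * star (monomial n z) ∂polydiskMeasure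
      = ∫ z, ∑ m ∈ (DirichletPoly.toFinsupp p P).support,
        polyCoeff p m P * (monomial m z * star (monomial n z)) ∂polydiskMeasure := by
    refine integral_congr_ae ?_
    filter_upwards [bohrLift_coe p P] with z hz
    rw [hz, Finset.sum_mul]
    exact Finset.sum_congr rfl fun m _ => mul_assoc _ _ _
  rw [h1, integral_finsetSum _ fun m _ => hint m, Finset.sum_eq_single n]
  · rw [integral_const_mul, monomialSq, ← integral_complex_ofReal]
    congr 1
    refine integral_congr_ae (Eventually.of_forall fun z => ?_)
    simp only [Complex.star_def, Complex.mul_conj, Complex.normSq_eq_norm_sq]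
  · intro m _ hm
    rw [integral_const_mul, integral_monomial_mul_of_ne hm, mul_zero]
  · intro hn
    have : polyCoeff p n P = 0 := Finsupp.notMem_support_iff.1 hn
    rw [integral_const_mul, this, zero_mul]

variable [Fact (1 ≤ p)]

/-- `‖P‖` is the `L ^ p` norm of the Bohr lift of `P`. -/
instance : SeminormedAddCommGroup (DirichletPoly p) :=
  SeminormedAddCommGroup.induced _ _ (bohrLift p)

instance : NormedSpace ℂ (DirichletPoly p) :=
  NormedSpace.induced ℂ _ _ (bohrLift p)

lemma norm_def (P : DirichletPoly p) : ‖P‖ = ‖bohrLift p P‖ := rfl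

lemma norm_polyCoeff_le (n : ℕ+) (P : DirichletPoly p) :
    ‖polyCoeff p n P‖ ≤ (monomialSq n)⁻¹ * ‖P‖ := by
  have hpos := monomialSq_pos n
  rw [inv_mul_eq_div, le_div_iff₀ hpos]
  have h0 : ‖polyCoeff p n P‖ * monomialSq n = ‖polyCoeff p n P * (monomialSq n : ℂ)‖ := by
    rw [norm_mul, Complex.norm_real, Real.norm_of_nonneg hpos.le]
  have hL := Lp.memLp (bohrLift p P)
  have hi : Integrable (bohrLift p P : (Nat.Primes → ℂ) → ℂ) polydiskMeasure :=
    hL.integrable Fact.out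
  rw [h0, ← integral_bohrLift_mul]
  calc ‖∫ z, (bohrLift p P : (Nat.Primes → ℂ) → ℂ) z * star (monomial n z) ∂polydiskMeasure‖
      ≤ ∫ z, ‖(bohrLift p P : (Nat.Primes → ℂ) → ℂ) z‖ ∂polydiskMeasure := by
        refine norm_integral_le_of_norm_le hi.norm ?_
        filter_upwards [norm_monomial_le n] with z hz
        rw [norm_mul, norm_star]
        exact mul_le_of_le_one_right (norm_nonneg _) hz
    _ = (eLpNorm (bohrLift p P : (Nat.Primes → ℂ) → ℂ) 1 polydiskMeasure).toReal := by
        rw [integral_norm_eq_lintegral_enorm hi.1, eLpNorm_one_eq_lintegral_enorm]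
    _ ≤ (eLpNorm (bohrLift p P : (Nat.Primes → ℂ) → ℂ) p polydiskMeasure).toReal :=
        ENNReal.toReal_mono hL.2.ne (eLpNorm_le_eLpNorm_of_exponent_le Fact.out hL.1)
    _ = ‖P‖ := by rw [norm_def, Lp.norm_def]

/-! ### The Bergman space of Dirichlet series -/

/-- The Bergman space of Dirichlet series: the completion of the Dirichlet polynomials for the
norm `‖P‖ = ‖D(P)‖_p`. -/
abbrev BergmanSpace : Type := Completion (DirichletPoly p)

/-- The `n`-th coefficient of the Dirichlet series of an element of the Bergman space: the
continuous extension of the `n`-th coefficient of Dirichlet polynomials. -/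
def coeffL (n : ℕ+) : BergmanSpace p →L[ℂ] ℂ :=
  ((polyCoeff p n).mkContinuous _ (norm_polyCoeff_le p n)).extend
    (Completion.toComplL (𝕜 := ℂ) (E := DirichletPoly p))

lemma coeffL_coe (n : ℕ+) (P : DirichletPoly p) :
    coeffL p n (P : BergmanSpace p) = polyCoeff p n P :=
  ContinuousLinearMap.extend_eq _ Completion.denseRange_coe
    (Completion.isUniformInducing_coe _) P

variable {p} in
/-- The coefficients `(a_n)` of the Dirichlet series `∑ a_n n ^ (-s)` of `f`. -/
def coeff (f : BergmanSpace p) (n : ℕ+) : ℂ := coeffL p n f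

/-! ### Dirichlet series and their abscissas -/

/-- The partial sum `∑ n ≤ N, a_n n ^ (-s)`. -/
def partialSum (a : ℕ+ → ℂ) (N : ℕ+) (s : ℂ) : ℂ :=
  ∑ n ∈ Finset.Icc 1 N, a n * ((n : ℕ) : ℂ) ^ (-s)

/-- The abscissa of uniform convergence of `∑ a_n n ^ (-s)`. -/
def abscissaUnif (a : ℕ+ → ℂ) : EReal :=
  sInf (Real.toEReal '' {r : ℝ | ∃ F : ℂ → ℂ,
    TendstoUniformlyOn (partialSum a) F atTop {s : ℂ | r < s.re}})

/-- The abscissa of boundedness of `∑ a_n n ^ (-s)`: the infimum of the `r` such that the sum of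
the series, which has to converge on some half-plane, has a bounded analytic extension `F` to
`Re s > r`. -/
def abscissaBdd (a : ℕ+ → ℂ) : EReal :=
  sInf (Real.toEReal '' {r : ℝ | ∃ F : ℂ → ℂ,
    AnalyticOnNhd ℂ F {s : ℂ | r < s.re} ∧
    (∃ M : ℝ, ∀ s : ℂ, r < s.re → ‖F s‖ ≤ M) ∧
    ∃ c : ℝ, ∀ s : ℂ, c < s.re → Tendsto (fun N => partialSum a N s) atTop (𝓝 (F s))})

end DirichletBergman

end

open MeasureTheory Filter Topology UniformSpace
open scoped ENNReal

noncomputable section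

namespace DirichletBergman

open scoped ComplexConjugate

/-! The Bohr lift turns evaluation at `w` into evaluation at the point `(q ^ (-w))` of the polydisk,
but this point is only useful once the series is known to converge for every `Re w > 1/2`. For this
it suffices that, for each `ε > 0`, the sequence `n ^ (-ε) * a_n` has `ℓ ^ 2` norm at most a
constant times the norm of `f` (`exists_sum_rpow_mul_sq_le`); Cauchy–Schwarz then gives absolute
convergence to the right of `1/2`, uniform on smaller half-planes, which is (i). Since the `L ^ p`
norm dominates the `L ^ 1` norm on a probability space, only `L ^ 1` matters here.

The `ℓ ^ 2` bound is proved one prime at a time, with damping `t = q ^ (-ε)`. The constants get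
multiplied over unboundedly many primes, so all but finitely many of them must be exactly `1`:
`sum_sq_le_diskNorm` is such a contractive inequality for small `t`, and `exists_sum_sq_le_diskNorm`
treats the finitely many remaining primes with some finite constant. Minkowski's inequality
tensorizes them (`sum_sq_le_integral_partialMonomial`).

For (ii), powers of the Bergman kernel are extremal for point evaluation on the disk. A product of
them reproduces lifts at the given point, and Hölder gives the upper bound (`norm_lift_le`);
polynomials approximating the equality case give the lower bound (`prod_le_of_norm_lift_le`). Each
prime contributes `(1 - q ^ (-2 Re w)) ^ (-2/p)`, and the Euler product assembles `ζ(2 Re w) ^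
(2/p)`.

For (iii), these norms blow up as `w` decreases to `1/2`, because `ζ` has a pole at `1`. By the
uniform boundedness principle some `f` is unbounded on `Re s > 1/2`. -/

/-! ### Moments and the reproducing formula on the disk -/

lemma integral_diskMeasure_norm_pow (k : ℕ) :
    ∫ x, ‖x‖ ^ (2 * k) ∂diskMeasure = ((k : ℝ) + 1)⁻¹ := by
  have h1 : ∫ x in Metric.ball (0 : ℂ) 1, ‖x‖ ^ (2 * k) =
      ∫ x : ℂ, (Set.Iio (1 : ℝ)).indicator (fun y => y ^ (2 * k)) ‖x‖ := by
    rw [← integral_indicator measurableSet_ball]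
    refine integral_congr_ae (Eventually.of_forall fun x => ?_)
    simp [Set.indicator]
  rw [integral_fun_norm_addHaar] at h1
  have h2 : ∫ y in Set.Ioi (0 : ℝ), y ^ (Module.finrank ℝ ℂ - 1) •
      (Set.Iio (1 : ℝ)).indicator (fun y => y ^ (2 * k)) y = (2 * (k : ℝ) + 2)⁻¹ := by
    have : ∀ y : ℝ, y ^ (Module.finrank ℝ ℂ - 1) •
        (Set.Iio (1 : ℝ)).indicator (fun y => y ^ (2 * k)) y =
        (Set.Iio (1 : ℝ)).indicator (fun y => y ^ (2 * k + 1)) y := by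
      intro y
      simp only [Complex.finrank_real_complex, Set.indicator, smul_eq_mul]
      split_ifs <;> simp; ring
    simp only [this]
    rw [setIntegral_indicator measurableSet_Iio, Set.Ioi_inter_Iio,
      ← integral_Ioc_eq_integral_Ioo, ← intervalIntegral.integral_of_le zero_le_one, integral_pow]
    push_cast
    simp [add_assoc]
    norm_num
  rw [h2] at h1
  rw [diskMeasure, integral_smul_measure, h1]
  have hv : (volume (Metric.ball (0 : ℂ) 1)).toReal ≠ 0 :=
    (ENNReal.toReal_pos (Metric.measure_ball_pos volume _ one_pos).ne' measure_ball_lt_top.ne).ne'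
  simp only [Complex.finrank_real_complex, ENNReal.toReal_inv, Measure.real, smul_eq_mul,
    nsmul_eq_mul]
  have : (k : ℝ) + 1 ≠ 0 := by positivity
  field_simp
  norm_num

lemma integrable_diskMeasure_of_continuousOn {E : Type*} [NormedAddCommGroup E] {F : ℂ → E}
    (hF : ContinuousOn F (Metric.closedBall 0 1)) : Integrable F diskMeasure := by
  have h : IntegrableOn F (Metric.ball 0 1) volume :=
    (hF.integrableOn_compact (isCompact_closedBall _ _)).mono_set Metric.ball_subset_closedBall
  exact h.smul_measure (ENNReal.inv_ne_top.2 (Metric.measure_ball_pos volume _ one_pos).ne')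

lemma integral_diskMeasure_pow_mul_conj (j k : ℕ) :
    ∫ x, x ^ j * conj x ^ k ∂diskMeasure = if j = k then ((k : ℂ) + 1)⁻¹ else 0 := by
  split_ifs with h
  · subst h
    have := congrArg (fun r : ℝ => (r : ℂ)) (integral_diskMeasure_norm_pow j)
    simp only [← integral_complex_ofReal] at this
    push_cast at this
    rw [← this]
    refine integral_congr_ae (Eventually.of_forall fun x => ?_)
    simp only [← mul_pow, Complex.mul_conj, Complex.normSq_eq_norm_sq]
    push_cast
    ring
  · have hab : ((j : ℂ) - k) ≠ 0 := sub_ne_zero.2 (by exact_mod_cast h)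
    -- This angle makes the rotation multiply the integrand by `exp (iπ) = -1`; by rotation
    -- invariance the integral equals its own opposite.
    set t : ℝ := Real.pi / ((j : ℝ) - k)
    set u := Complex.exp (t * Complex.I)
    have ht : ‖u‖ = 1 := Complex.norm_exp_ofReal_mul_I t
    have hu : u ^ j * conj u ^ k = -1 := by
      rw [← map_pow, ← Complex.exp_pi_mul_I, map_pow, ← Complex.exp_conj,
        ← Complex.exp_nat_mul, ← Complex.exp_nat_mul, ← Complex.exp_add]
      congr 1
      simp only [map_mul, Complex.conj_ofReal, Complex.conj_I, t]
      push_cast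
      field_simp
      ring
    have h1 : ∫ x, x ^ j * conj x ^ k ∂diskMeasure =
        ∫ x, (u * x) ^ j * conj (u * x) ^ k ∂diskMeasure := by
      conv_lhs => rw [← diskMeasure_rotate u ht]
      rw [integral_map (by fun_prop) (by fun_prop)]
    have h2 : ∀ x : ℂ, (u * x) ^ j * conj (u * x) ^ k = (-1) * (x ^ j * conj x ^ k) := by
      intro x
      rw [← hu, map_mul]
      ring
    simp only [h2] at h1
    rw [integral_const_mul] at h1
    linear_combination h1 / 2

/-- Taylor polynomials converge uniformly on every disk strictly smaller than one of analyticity,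
hence the two intermediate radii. This extends identities from powers to functions holomorphic past
the closed disk, and later supplies polynomial test functions. -/
lemma exists_taylor_tendstoUniformlyOn {F : ℂ → ℂ} {R : ℝ} (hR : 1 < R)
    (hF : DifferentiableOn ℂ F (Metric.ball 0 R)) :
    ∃ b : ℕ → ℂ, TendstoUniformlyOn (fun m x => ∑ k ∈ Finset.range m, b k * x ^ k) F atTop
      (Metric.closedBall 0 1) := by
  obtain ⟨R', h1, h2⟩ := exists_between hR
  obtain ⟨R'', h3, h4⟩ := exists_between h1
  lift R' to NNReal using (by linarith)
  lift R'' to NNReal using (by linarith)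
  have hp := (hF.mono (Metric.closedBall_subset_ball h2)).hasFPowerSeriesOnBall (by
    exact_mod_cast (zero_lt_one.trans h1))
  have hT := hp.tendstoUniformlyOn' (r' := R'') (by exact_mod_cast h4)
  refine ⟨fun k => (cauchyPowerSeries F 0 R').coeff k, ?_⟩
  refine (hT.mono (Metric.closedBall_subset_ball h3)).congr (Eventually.of_forall fun m x _ => ?_)
  simp only [FormalMultilinearSeries.partialSum, sub_zero,
    FormalMultilinearSeries.apply_eq_pow_smul_coeff, smul_eq_mul]
  exact Finset.sum_congr rfl fun k _ => mul_comm _ _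

lemma ae_mem_closedBall : ∀ᵐ x ∂diskMeasure, x ∈ Metric.closedBall (0 : ℂ) 1 := by
  filter_upwards [ae_mem_disk] with x hx
  simpa using hx.le

/-- Expand the kernel as `∑ (k + 1) (ζ x̄) ^ k`. Orthogonality keeps only `k = j`, and the factor `j
+ 1` cancels the moment `1 / (j + 1)`. -/
lemma integral_pow_mul_bergmanKernel {ζ : ℂ} (hζ : ‖ζ‖ < 1) (j : ℕ) :
    ∫ x, x ^ j * ((1 - ζ * conj x) ^ 2)⁻¹ ∂diskMeasure = ζ ^ j := by
  have hint : ∀ k : ℕ, Integrable (fun x : ℂ => x ^ j * ((k + 1) * (ζ * conj x) ^ k))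
      diskMeasure := fun k => integrable_diskMeasure_of_continuousOn (by fun_prop)
  have hval : ∀ k : ℕ, ∫ x, x ^ j * ((k + 1) * (ζ * conj x) ^ k) ∂diskMeasure =
      if k = j then ζ ^ j else 0 := by
    intro k
    have : ∀ x : ℂ, x ^ j * ((k + 1) * (ζ * conj x) ^ k) =
        ((k + 1) * ζ ^ k) * (x ^ j * conj x ^ k) := fun x => by ring
    simp only [this]
    rw [integral_const_mul, integral_diskMeasure_pow_mul_conj]
    by_cases h : j = k
    · subst h
      have : (j : ℂ) + 1 ≠ 0 := by exact_mod_cast j.succ_ne_zero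
      simp; field_simp
    · simp [h, Ne.symm h]
  have hgeo : ∀ y : ℂ, ‖y‖ < 1 → HasSum (fun k : ℕ => ((k : ℂ) + 1) * y ^ k) ((1 - y) ^ 2)⁻¹ := by
    intro y hy
    simpa using hasSum_choose_mul_geometric_of_norm_lt_one 1 hy
  have hsum : Summable fun k : ℕ => ∫ x, ‖x ^ j * ((k + 1) * (ζ * conj x) ^ k)‖ ∂diskMeasure := by
    have hs : Summable fun k : ℕ => ((k : ℝ) + 1) * ‖ζ‖ ^ k := by
      have := (hasSum_choose_mul_geometric_of_norm_lt_one (𝕜 := ℝ) 1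
        (r := ‖ζ‖) (by simpa using hζ)).summable
      simpa using this
    refine hs.of_nonneg_of_le (fun k => integral_nonneg fun _ => norm_nonneg _) fun k => ?_
    have : ∀ᵐ x ∂diskMeasure, ‖x ^ j * ((k + 1) * (ζ * conj x) ^ k)‖ ≤ ((k : ℝ) + 1) * ‖ζ‖ ^ k := by
      filter_upwards [ae_mem_disk] with x hx
      have e1 : ‖(k : ℂ) + 1‖ = (k : ℝ) + 1 := by
        exact_mod_cast Complex.norm_natCast (k + 1)
      rw [norm_mul, norm_mul, norm_pow, norm_pow, norm_mul, e1, RCLike.norm_conj, mul_pow]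
      have := pow_le_one₀ (n := j) (norm_nonneg x) hx.le
      have h' := pow_le_one₀ (n := k) (norm_nonneg x) hx.le
      calc ‖x‖ ^ j * (((k : ℝ) + 1) * (‖ζ‖ ^ k * ‖x‖ ^ k))
          ≤ 1 * (((k : ℝ) + 1) * (‖ζ‖ ^ k * 1)) := by gcongr
        _ = _ := by ring
    refine (integral_mono_ae (hint k).norm (integrable_const _) this).trans ?_
    simp
  have := hasSum_integral_of_summable_integral_norm hint hsum
  have h3 : ∫ x, ∑' k : ℕ, x ^ j * ((k + 1) * (ζ * conj x) ^ k) ∂diskMeasure =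
      ∫ x, x ^ j * ((1 - ζ * conj x) ^ 2)⁻¹ ∂diskMeasure := by
    refine integral_congr_ae ?_
    filter_upwards [ae_mem_disk] with x hx
    rw [tsum_mul_left, (hgeo _ _).tsum_eq]
    rw [norm_mul, RCLike.norm_conj]
    nlinarith [norm_nonneg x, norm_nonneg ζ]
  simp only [hval] at this
  rw [← h3]
  exact this.unique (hasSum_ite_eq j _)

lemma one_sub_mul_conj_ne_zero {ζ x : ℂ} (hζ : ‖ζ‖ < 1) (hx : ‖x‖ ≤ 1) : 1 - ζ * conj x ≠ 0 := by
  intro h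
  have : ‖ζ * conj x‖ = 1 := by rw [← sub_eq_zero.1 h, norm_one]
  rw [norm_mul, RCLike.norm_conj] at this
  nlinarith [norm_nonneg x, norm_nonneg ζ]

lemma continuousOn_bergmanKernel {ζ : ℂ} (hζ : ‖ζ‖ < 1) :
    ContinuousOn (fun x : ℂ => ((1 - ζ * conj x) ^ 2)⁻¹) (Metric.closedBall 0 1) :=
  ContinuousOn.inv₀ (by fun_prop) fun x hx =>
    pow_ne_zero 2 (one_sub_mul_conj_ne_zero hζ (by simpa using hx))

/-- Uniform limits on the closed disk may be integrated against a continuous function. -/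
lemma tendsto_integral_mul_of_tendstoUniformlyOn {f : ℕ → ℂ → ℂ} {F g : ℂ → ℂ}
    (hf : ∀ m, Continuous (f m))
    (h : TendstoUniformlyOn f F atTop (Metric.closedBall 0 1))
    (hg : ContinuousOn g (Metric.closedBall 0 1)) :
    Tendsto (fun m => ∫ x, f m x * g x ∂diskMeasure) atTop (𝓝 (∫ x, F x * g x ∂diskMeasure)) := by
  have hFc : ContinuousOn F (Metric.closedBall 0 1) :=
    h.continuousOn (Frequently.of_forall fun m => (hf m).continuousOn)
  obtain ⟨C, hC⟩ := (isCompact_closedBall (0 : ℂ) 1).exists_bound_of_continuousOn hg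
  obtain ⟨C', hC'⟩ := (isCompact_closedBall (0 : ℂ) 1).exists_bound_of_continuousOn hFc
  refine tendsto_integral_filter_of_dominated_convergence (fun _ => (C' + 1) * C)
    (Eventually.of_forall fun m => (integrable_diskMeasure_of_continuousOn
      ((hf m).continuousOn.mul hg)).aestronglyMeasurable) ?_ (integrable_const _) ?_
  · filter_upwards [Metric.tendstoUniformlyOn_iff.1 h 1 one_pos] with m hm
    filter_upwards [ae_mem_closedBall] with x hx
    rw [norm_mul]
    have h1 := hm x hx
    rw [dist_comm, dist_eq_norm] at h1
    have h2 := norm_le_norm_add_norm_sub' (f m x) (F x)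
    have h3 := hC' x hx
    have h4 := (norm_nonneg _).trans h3
    gcongr
    · linarith
    · exact hC x hx
  · filter_upwards [ae_mem_closedBall] with x hx
    exact (h.tendsto_at hx).mul_const _

/-- The reproducing formula of the Bergman kernel of the disk. -/
lemma integral_mul_bergmanKernel {ζ : ℂ} (hζ : ‖ζ‖ < 1) {F : ℂ → ℂ} {R : ℝ} (hR : 1 < R)
    (hF : DifferentiableOn ℂ F (Metric.ball 0 R)) :
    ∫ x, F x * ((1 - ζ * conj x) ^ 2)⁻¹ ∂diskMeasure = F ζ := by
  obtain ⟨b, hb⟩ := exists_taylor_tendstoUniformlyOn hR hF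
  have h1 := tendsto_integral_mul_of_tendstoUniformlyOn (fun m => by fun_prop) hb
    (continuousOn_bergmanKernel hζ)
  refine tendsto_nhds_unique h1 ((hb.tendsto_at (x := ζ) (by simpa using hζ.le)).congr fun m => ?_)
  have hi : ∀ k : ℕ, Integrable (fun x : ℂ => b k * (x ^ k * ((1 - ζ * conj x) ^ 2)⁻¹))
      diskMeasure := fun k => integrable_diskMeasure_of_continuousOn
    (continuousOn_const.mul ((continuousOn_id.pow k).mul (continuousOn_bergmanKernel hζ)))
  simp only [Finset.sum_mul, mul_assoc]
  rw [integral_finsetSum _ fun k _ => hi k]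
  refine Finset.sum_congr rfl fun k _ => ?_
  rw [integral_const_mul, integral_pow_mul_bergmanKernel hζ]

/-! ### Integration over the polydisk by coordinates -/

lemma integral_prod_coordinates {𝕜 : Type*} [RCLike 𝕜] (S : Finset Nat.Primes)
    {f : Nat.Primes → ℂ → 𝕜} (hf : ∀ q, AEStronglyMeasurable (f q) diskMeasure) :
    ∫ z, ∏ q ∈ S, f q (z q) ∂polydiskMeasure = ∏ q ∈ S, ∫ x, f q x ∂diskMeasure := by
  have hm : AEStronglyMeasurable (fun y : (q : S) → ℂ => ∏ q : S, f q (y q))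
      (Measure.pi fun _ : S => diskMeasure) := by
    refine Finset.aestronglyMeasurable_fun_prod _ fun q _ => ?_
    exact (hf q).comp_quasiMeasurePreserving
      (measurePreserving_eval (fun _ : S => diskMeasure) q).quasiMeasurePreserving
  have := integral_restrict_infinitePi (μ := fun _ : Nat.Primes => diskMeasure) (s := S) hm
  rw [integral_fintype_prod_eq_prod (μ := fun _ : S => diskMeasure) (fun q : S => f q)] at this
  rw [← Finset.prod_coe_sort, ← this, polydiskMeasure]
  refine integral_congr_ae (Eventually.of_forall fun z => ?_)
  simp

/-- Replacing one coordinate by an independent sample does not change the law. This gives Fubini in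
a single variable without splitting the index set. -/
lemma measurePreserving_update (q : Nat.Primes) :
    MeasurePreserving (fun y : (Nat.Primes → ℂ) × ℂ => Function.update y.1 q y.2)
      (polydiskMeasure.prod diskMeasure) polydiskMeasure := by
  have hm : Measurable (fun y : (Nat.Primes → ℂ) × ℂ => Function.update y.1 q y.2) := by
    refine measurable_pi_lambda _ fun r => ?_
    by_cases h : r = q
    · subst h; simpa using measurable_snd
    · simp only [Function.update_of_ne h]; fun_prop
  refine ⟨hm, ?_⟩
  refine Measure.eq_infinitePi _ fun s t ht => ?_
  rw [Measure.map_apply hm (.pi s.countable_toSet fun _ _ => ht _)]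
  -- On a box, the constraint at `q`, if there is one, falls on the new sample; all the others stay
  -- on the old point.
  have : (fun y : (Nat.Primes → ℂ) × ℂ => Function.update y.1 q y.2) ⁻¹' ((s : Set _).pi t) =
      (((s.erase q : Finset _) : Set Nat.Primes).pi t) ×ˢ (if q ∈ s then t q else Set.univ) := by
    ext ⟨y, x⟩
    simp only [Set.mem_preimage, Set.mem_pi, Finset.mem_coe, Finset.mem_erase, Set.mem_prod]
    constructor
    · intro h
      refine ⟨fun r hr => by simpa [Function.update_of_ne hr.1] using h r hr.2, ?_⟩
      split_ifs with hq
      · simpa using h q hq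
      · trivial
    · rintro ⟨h1, h2⟩ r hr
      by_cases hrq : r = q
      · subst hrq; simpa [hr] using h2
      · simpa [Function.update_of_ne hrq] using h1 r ⟨hrq, hr⟩
  rw [this, Measure.prod_prod, polydiskMeasure, Measure.infinitePi_pi _ fun i _ => ht i]
  split_ifs with hq
  · rw [Finset.prod_erase_mul _ _ hq]
  · simp [Finset.erase_eq_of_notMem hq]

lemma integral_update {E : Type*} [NormedAddCommGroup E] [NormedSpace ℝ E] (q : Nat.Primes)
    {F : (Nat.Primes → ℂ) → E} (hF : Integrable F polydiskMeasure) :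
    ∫ z, ∫ x, F (Function.update z q x) ∂diskMeasure ∂polydiskMeasure =
      ∫ z, F z ∂polydiskMeasure := by
  have h := measurePreserving_update q
  have h1 := integral_prod _ (h.integrable_comp_of_integrable hF)
  have h2 := integral_map (μ := polydiskMeasure.prod diskMeasure) h.measurable.aemeasurable
    (f := F) (by rw [h.map_eq]; exact hF.1)
  rw [h.map_eq] at h2
  exact (h2.trans h1).symm

/-! ### From the `L ^ 1` norm on the disk to weighted `ℓ ^ 2` norms of coefficients -/

lemma integral_polynomial_mul_conj_pow (a : ℕ → ℂ) {K j : ℕ} (hj : j < K) :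
    ∫ x, (∑ k ∈ Finset.range K, a k * x ^ k) * conj x ^ j ∂diskMeasure = a j * ((j : ℂ) + 1)⁻¹ := by
  simp only [Finset.sum_mul, mul_assoc]
  rw [integral_finsetSum _ fun k _ => integrable_diskMeasure_of_continuousOn (by fun_prop)]
  simp only [integral_const_mul, integral_diskMeasure_pow_mul_conj]
  rw [Finset.sum_eq_single j]
  · simp
  · intro k _ hk; simp [hk]
  · intro h; exact absurd (Finset.mem_range.2 hj) h

/-- The `L ^ 1` norm on the disk of the polynomial `∑ k < K, a k * x ^ k`. -/
def diskNorm (K : ℕ) (a : ℕ → ℂ) : ℝ :=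
  ∫ x, ‖∑ k ∈ Finset.range K, a k * x ^ k‖ ∂diskMeasure

lemma integrable_diskPolynomial (K : ℕ) (a : ℕ → ℂ) :
    Integrable (fun x : ℂ => ∑ k ∈ Finset.range K, a k * x ^ k) diskMeasure :=
  integrable_diskMeasure_of_continuousOn (by fun_prop)

lemma norm_integral_diskPolynomial_mul_le (K : ℕ) (a : ℕ → ℂ) {h : ℂ → ℂ} {C : ℝ}
    (hC : ∀ᵐ x ∂diskMeasure, ‖h x‖ ≤ C) :
    ‖∫ x, (∑ k ∈ Finset.range K, a k * x ^ k) * h x ∂diskMeasure‖ ≤ C * diskNorm K a := by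
  rw [diskNorm, ← integral_const_mul]
  refine norm_integral_le_of_norm_le ((integrable_diskPolynomial K a).norm.const_mul _) ?_
  filter_upwards [hC] with x hx
  rw [norm_mul, mul_comm]
  gcongr

lemma diskNorm_nonneg (K : ℕ) (a : ℕ → ℂ) : 0 ≤ diskNorm K a :=
  integral_nonneg fun _ => norm_nonneg _

/-- Test against `x̄ ^ j`, which is bounded by `1` on the disk; the factor `j + 1` is the inverse of
its moment. -/
lemma norm_coeff_le_diskNorm (a : ℕ → ℂ) {K j : ℕ} (hj : j < K) :
    ‖a j‖ ≤ (j + 1) * diskNorm K a := by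
  have h := norm_integral_diskPolynomial_mul_le K a (h := fun x => conj x ^ j) (C := 1) (by
    filter_upwards [ae_mem_disk] with x hx
    rw [norm_pow, RCLike.norm_conj]
    exact pow_le_one₀ (norm_nonneg _) hx.le)
  rw [integral_polynomial_mul_conj_pow a hj, norm_mul, norm_inv, one_mul] at h
  have e1 : ‖(j : ℂ) + 1‖ = (j : ℝ) + 1 := by exact_mod_cast Complex.norm_natCast (j + 1)
  rw [e1, ← div_eq_mul_inv, div_le_iff₀ (by positivity)] at h
  linarith

lemma sum_geometric_weight_le (K : ℕ) :
    ∑ k ∈ Finset.range K, ((k : ℝ) + 2) * (1 / 64) ^ (k + 1) ≤ 1 / 16 := by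
  -- The subtracted remainder makes the induction close; the linear factor is absorbed by `K + 2 ≤ 2
  -- * 2 ^ K`.
  have h : ∀ K : ℕ, ∑ k ∈ Finset.range K, ((k : ℝ) + 2) * (1 / 64) ^ (k + 1) ≤
      1 / 16 - (1 / 16) * (1 / 32) ^ K := by
    intro K
    induction K with
    | zero => simp
    | succ K ih =>
      rw [Finset.sum_range_succ]
      have h2 : (K : ℝ) + 2 ≤ 2 * 2 ^ K := by
        have := K.lt_two_pow_self
        have h1 : K + 2 ≤ 2 * 2 ^ K := by have := Nat.one_le_two_pow (n := K); omega
        exact_mod_cast h1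
      have h3 : ((K : ℝ) + 2) * (1 / 64) ^ (K + 1) ≤ (1 / 32) * (1 / 32) ^ K := by
        calc ((K : ℝ) + 2) * (1 / 64) ^ (K + 1) ≤ (2 * 2 ^ K) * (1 / 64) ^ (K + 1) := by gcongr
          _ = (1 / 32) * ((2 * (1 / 64)) ^ K) := by rw [mul_pow]; ring
          _ = _ := by norm_num
      have : (0 : ℝ) < (1 / 32) ^ K := by positivity
      rw [pow_succ (1 / 32 : ℝ)]
      linarith
  refine (h K).trans ?_
  have : (0 : ℝ) < (1 / 32) ^ K := by positivity
  linarith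

lemma geometric_weight_le (k : ℕ) : ((k : ℝ) + 2) * (1 / 64) ^ (k + 1) ≤ 1 / 16 := by
  refine le_trans ?_ (sum_geometric_weight_le (k + 1))
  exact Finset.single_le_sum (f := fun k : ℕ => ((k : ℝ) + 2) * (1 / 64) ^ (k + 1))
    (fun _ _ => by positivity) (Finset.self_mem_range_succ k)

/-- The crude coefficient bound already shows that the terms other than the constant one cost
little. The weight that appears squared is at most `1/16`, so its square is bounded by itself and
summed. -/
lemma sum_sq_tail_le (a : ℕ → ℂ) (K : ℕ) :
    ∑ k ∈ Finset.range K, (1 / 64 : ℝ) ^ (2 * (k + 1)) * ‖a (k + 1)‖ ^ 2 ≤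
      1 / 16 * diskNorm (K + 1) a ^ 2 := by
  have hM := diskNorm_nonneg (K + 1) a
  calc _ ≤ ∑ k ∈ Finset.range K, ((k : ℝ) + 2) * (1 / 64) ^ (k + 1) * diskNorm (K + 1) a ^ 2 := by
        refine Finset.sum_le_sum fun k hk => ?_
        have h1 := norm_coeff_le_diskNorm a (Nat.add_lt_add_right (Finset.mem_range.1 hk) 1)
        push_cast at h1
        calc (1 / 64 : ℝ) ^ (2 * (k + 1)) * ‖a (k + 1)‖ ^ 2
            ≤ (1 / 64 : ℝ) ^ (2 * (k + 1)) * (((k : ℝ) + 1 + 1) * diskNorm (K + 1) a) ^ 2 := by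
              gcongr
          _ = (((k : ℝ) + 2) * (1 / 64) ^ (k + 1)) ^ 2 * diskNorm (K + 1) a ^ 2 := by ring
          _ ≤ ((k : ℝ) + 2) * (1 / 64) ^ (k + 1) * diskNorm (K + 1) a ^ 2 := by
              gcongr
              have h0 : 0 ≤ ((k : ℝ) + 2) * (1 / 64) ^ (k + 1) := by positivity
              nlinarith [geometric_weight_le k]
    _ = (∑ k ∈ Finset.range K, ((k : ℝ) + 2) * (1 / 64) ^ (k + 1)) * diskNorm (K + 1) a ^ 2 := by
        rw [Finset.sum_mul]
    _ ≤ _ := by gcongr; exact sum_geometric_weight_le K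

/-- Duality with a perturbation of the constant `1` that stays unimodular. To first order the
pairing is `1 + Q`, with `Q` a weighted square sum of the higher coefficients. The error is at most
`4 L ^ 2 M`, where `L` bounds `|G|`; as `L ^ 2 ≤ Q / 16` and `M ≤ 2`, it is at most `Q / 2`. Thus `1
+ Q / 2 ≤ M`, and squaring gives `1 + Q ≤ M ^ 2`. -/
lemma sum_sq_le_diskNorm_of_eq_one (a : ℕ → ℂ) (K : ℕ) (h0 : a 0 = 1)
    (hM : diskNorm (K + 1) a ≤ 2) :
    1 + ∑ k ∈ Finset.range K, (1 / 64 : ℝ) ^ (2 * (k + 1)) * ‖a (k + 1)‖ ^ 2 ≤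
      diskNorm (K + 1) a ^ 2 := by
  set M := diskNorm (K + 1) a
  set f : ℂ → ℂ := fun x => ∑ k ∈ Finset.range (K + 1), a k * x ^ k
  set r : ℝ := 1 / 64
  have hr : 0 < r := by norm_num [r]
  set Q : ℝ := ∑ k ∈ Finset.range K, r ^ (k + 1) * (‖a (k + 1)‖ ^ 2 / (k + 2))
  set L : ℝ := ∑ k ∈ Finset.range K, r ^ (k + 1) * ‖a (k + 1)‖
  set G : ℂ → ℂ := fun x => ∑ k ∈ Finset.range K, r ^ (k + 1) * a (k + 1) * x ^ (k + 1)
  have hGc : Continuous G := by fun_prop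
  have hGL : ∀ᵐ x ∂diskMeasure, ‖G x‖ ≤ L := by
    filter_upwards [ae_mem_disk] with x hx
    refine norm_sum_le_of_le _ fun k _ => ?_
    rw [norm_mul, norm_mul, norm_pow, norm_pow, Complex.norm_real, Real.norm_of_nonneg hr.le]
    exact mul_le_of_le_one_right (by positivity) (pow_le_one₀ (norm_nonneg _) hx.le)
  have hL0 : 0 ≤ L := Finset.sum_nonneg fun k _ => by positivity
  -- Smallness of `L` ensures `‖u‖ ≤ 2 L ≤ 1`, the range where `exp u - 1 - u` is bounded by `‖u‖ ^
  -- 2`.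
  have hL1 : L ≤ 1 / 8 := by
    calc L ≤ ∑ k ∈ Finset.range K, 2 * (((k : ℝ) + 2) * r ^ (k + 1)) := by
          refine Finset.sum_le_sum fun k hk => ?_
          have h1 := norm_coeff_le_diskNorm a (Nat.add_lt_add_right (Finset.mem_range.1 hk) 1)
          push_cast at h1
          have h2 : ‖a (k + 1)‖ ≤ ((k : ℝ) + 2) * 2 := h1.trans (by
            rw [add_assoc]; norm_num; gcongr)
          calc r ^ (k + 1) * ‖a (k + 1)‖ ≤ r ^ (k + 1) * (((k : ℝ) + 2) * 2) := by gcongr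
            _ = _ := by ring
      _ ≤ 1 / 8 := by
          rw [← Finset.mul_sum]
          linarith [sum_geometric_weight_le K]
  -- Cauchy–Schwarz, with the factor `k + 2` moved to the side that sums to at most `1/16`.
  have hLQ : L ^ 2 ≤ 1 / 16 * Q := by
    have := Finset.sum_sq_le_sum_mul_sum_of_sq_le_mul (Finset.range K)
      (f := fun k => ((k : ℝ) + 2) * r ^ (k + 1))
      (g := fun k => r ^ (k + 1) * (‖a (k + 1)‖ ^ 2 / (k + 2)))
      (r := fun k => r ^ (k + 1) * ‖a (k + 1)‖) (fun k _ => by positivity)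
      (fun k _ => by positivity) (fun k _ => le_of_eq (by field_simp))
    refine this.trans ?_
    gcongr
    exact sum_geometric_weight_le K
  have hTQ : ∑ k ∈ Finset.range K, r ^ (2 * (k + 1)) * ‖a (k + 1)‖ ^ 2 ≤ Q := by
    refine Finset.sum_le_sum fun k _ => ?_
    have h1 := geometric_weight_le k
    have h2 : r ^ (k + 1) ≤ 1 / ((k : ℝ) + 2) := by
      rw [le_div_iff₀ (by positivity)]
      linarith
    calc r ^ (2 * (k + 1)) * ‖a (k + 1)‖ ^ 2 = r ^ (k + 1) * (‖a (k + 1)‖ ^ 2 * r ^ (k + 1)) := by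
          ring
      _ ≤ r ^ (k + 1) * (‖a (k + 1)‖ ^ 2 * (1 / ((k : ℝ) + 2))) := by gcongr
      _ = _ := by ring
  -- pair `f` with the unimodular function `exp (conj G - G)`
  set u : ℂ → ℂ := fun x => conj (G x) - G x
  have hucont : Continuous u := by fun_prop
  have hu_norm : ∀ x, ‖Complex.exp (u x)‖ = 1 := by
    intro x
    rw [Complex.norm_exp]
    simp [u]
  have hu_le : ∀ᵐ x ∂diskMeasure, ‖u x‖ ≤ 2 * L := by
    filter_upwards [hGL] with x hx
    refine (norm_sub_le _ _).trans ?_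
    rw [RCLike.norm_conj]
    linarith
  have hrem : ∀ᵐ x ∂diskMeasure, ‖Complex.exp (u x) - 1 - u x‖ ≤ 4 * L ^ 2 := by
    filter_upwards [hu_le] with x hx
    refine (Complex.norm_exp_sub_one_sub_id_le (hx.trans (by linarith))).trans ?_
    nlinarith [norm_nonneg (u x)]
  have hfc : Continuous f := by fun_prop
  have i1 : ∫ x, f x ∂diskMeasure = 1 := by
    have := integral_polynomial_mul_conj_pow a (K := K + 1) (j := 0) (by omega)
    simpa [h0] using this
  -- `G` vanishes at the origin, so `f * G` has only positive powers; the factor `conj x ^ 0` brings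
  -- them to the orthogonality relation.
  have i2 : ∫ x, f x * G x ∂diskMeasure = 0 := by
    have : ∀ x, f x * G x = ∑ j ∈ Finset.range (K + 1), ∑ k ∈ Finset.range K,
        (a j * (r ^ (k + 1) * a (k + 1))) * (x ^ (j + (k + 1)) * conj x ^ 0) := by
      intro x
      simp only [f, G, Finset.sum_mul_sum]
      refine Finset.sum_congr rfl fun j _ => Finset.sum_congr rfl fun k _ => ?_
      ring
    simp only [this]
    rw [integral_finsetSum _ fun j _ => integrable_diskMeasure_of_continuousOn (by fun_prop)]
    refine Finset.sum_eq_zero fun j _ => ?_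
    rw [integral_finsetSum _ fun k _ => integrable_diskMeasure_of_continuousOn (by fun_prop)]
    refine Finset.sum_eq_zero fun k _ => ?_
    rw [integral_const_mul, integral_diskMeasure_pow_mul_conj, if_neg (by omega), mul_zero]
  have i3 : ∫ x, f x * conj (G x) ∂diskMeasure = (Q : ℂ) := by
    have : ∀ x, f x * conj (G x) = ∑ k ∈ Finset.range K,
        (r ^ (k + 1) * conj (a (k + 1))) * (f x * conj x ^ (k + 1)) := by
      intro x
      simp only [G, map_sum, map_mul, map_pow, Complex.conj_ofReal, Finset.mul_sum]
      refine Finset.sum_congr rfl fun k _ => ?_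
      ring
    simp only [this]
    rw [integral_finsetSum _ fun k _ => integrable_diskMeasure_of_continuousOn (by fun_prop)]
    simp only [Q]
    push_cast
    refine Finset.sum_congr rfl fun k hk => ?_
    rw [integral_const_mul,
      integral_polynomial_mul_conj_pow a (Nat.add_lt_add_right (Finset.mem_range.1 hk) 1),
      ← Complex.mul_conj']
    push_cast
    ring
  have hi : ∀ {g : ℂ → ℂ}, Continuous g → Integrable g diskMeasure := fun hg =>
    integrable_diskMeasure_of_continuousOn hg.continuousOn
  have key : ∫ x, f x * Complex.exp (u x) ∂diskMeasure =
      1 + (Q : ℂ) + ∫ x, f x * (Complex.exp (u x) - 1 - u x) ∂diskMeasure := by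
    have : ∀ x, f x * Complex.exp (u x) =
        f x + (f x * conj (G x) - f x * G x) + f x * (Complex.exp (u x) - 1 - u x) := by
      intro x; simp only [u]; ring
    simp only [this]
    rw [integral_add (hi (by fun_prop)) (hi (by fun_prop)), integral_add (hi hfc)
      (hi (by fun_prop)), integral_sub (hi (by fun_prop)) (hi (by fun_prop)), i1, i2, i3, sub_zero]
  have b1 : ‖∫ x, f x * Complex.exp (u x) ∂diskMeasure‖ ≤ 1 * M :=
    norm_integral_diskPolynomial_mul_le (K + 1) a (Eventually.of_forall fun x => (hu_norm x).le)
  have b2 : ‖∫ x, f x * (Complex.exp (u x) - 1 - u x) ∂diskMeasure‖ ≤ 4 * L ^ 2 * M :=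
    norm_integral_diskPolynomial_mul_le (K + 1) a hrem
  have hQ0 : 0 ≤ Q := Finset.sum_nonneg fun k _ => by positivity
  have b3 : 1 + Q ≤ 1 * M + 4 * L ^ 2 * M := by
    have : (1 + (Q : ℂ)) = ∫ x, f x * Complex.exp (u x) ∂diskMeasure -
        ∫ x, f x * (Complex.exp (u x) - 1 - u x) ∂diskMeasure := by rw [key]; ring
    have h := norm_sub_le (∫ x, f x * Complex.exp (u x) ∂diskMeasure)
      (∫ x, f x * (Complex.exp (u x) - 1 - u x) ∂diskMeasure)
    rw [← this] at h
    have e : ‖1 + (Q : ℂ)‖ = 1 + Q := by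
      rw [← Complex.ofReal_one, ← Complex.ofReal_add, Complex.norm_real,
        Real.norm_of_nonneg (by positivity)]
    rw [e] at h
    linarith
  have b4 : 1 + Q / 2 ≤ M := by nlinarith [sq_nonneg L]
  nlinarith

/-- A contractive inequality from the Bergman space `A ^ 1` into a weighted Hardy space. -/
lemma sum_sq_le_diskNorm {t : ℝ} (ht0 : 0 ≤ t) (ht : t ≤ 1 / 64) (a : ℕ → ℂ) (K : ℕ) :
    ∑ k ∈ Finset.range K, t ^ (2 * k) * ‖a k‖ ^ 2 ≤ diskNorm K a ^ 2 := by
  rcases K with _ | K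
  · simp [sq_nonneg]
  have h1 : ∑ k ∈ Finset.range (K + 1), t ^ (2 * k) * ‖a k‖ ^ 2 ≤
      ‖a 0‖ ^ 2 + ∑ k ∈ Finset.range K, (1 / 64 : ℝ) ^ (2 * (k + 1)) * ‖a (k + 1)‖ ^ 2 := by
    rw [Finset.sum_range_succ', add_comm]
    simp only [mul_zero, pow_zero, one_mul]
    gcongr
  refine h1.trans ?_
  -- Without a constant term the tail estimate alone suffices; otherwise divide by `a 0`.
  by_cases h0 : a 0 = 0
  · have := sum_sq_tail_le a K
    rw [h0]
    simp only [norm_zero]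
    nlinarith [sq_nonneg (diskNorm (K + 1) a)]
  set b : ℕ → ℂ := fun k => a k / a 0
  have hpos : 0 < ‖a 0‖ := norm_pos_iff.2 h0
  have hab : ∀ k, a k = a 0 * b k := fun k => by simp only [b]; field_simp
  have hnorm : diskNorm (K + 1) a = ‖a 0‖ * diskNorm (K + 1) b := by
    rw [diskNorm, diskNorm, ← integral_const_mul]
    refine integral_congr_ae (Eventually.of_forall fun x => ?_)
    simp only
    rw [← norm_mul, Finset.mul_sum]
    congr 1
    refine Finset.sum_congr rfl fun k _ => ?_
    rw [← mul_assoc, ← hab]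
  have hmain : 1 + ∑ k ∈ Finset.range K, (1 / 64 : ℝ) ^ (2 * (k + 1)) * ‖b (k + 1)‖ ^ 2 ≤
      diskNorm (K + 1) b ^ 2 := by
    -- If the norm `M` exceeds `2`, then `1 ≤ M ^ 2 / 4` and the tail is at most `M ^ 2 / 16`, so
    -- duality is not needed.
    by_cases hM : diskNorm (K + 1) b ≤ 2
    · exact sum_sq_le_diskNorm_of_eq_one b K (by simp [b, h0]) hM
    · have := sum_sq_tail_le b K
      nlinarith
  calc _ = ‖a 0‖ ^ 2 *
        (1 + ∑ k ∈ Finset.range K, (1 / 64 : ℝ) ^ (2 * (k + 1)) * ‖b (k + 1)‖ ^ 2) := by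
        rw [mul_add, mul_one, Finset.mul_sum]
        congr 1
        refine Finset.sum_congr rfl fun k _ => ?_
        rw [hab (k + 1), norm_mul]
        ring
    _ ≤ ‖a 0‖ ^ 2 * diskNorm (K + 1) b ^ 2 := by gcongr
    _ = _ := by rw [hnorm]; ring

/-- The linear growth in the coefficient bound is absorbed by the geometric weight. No contraction
is claimed: this serves only the finitely many primes with `q ^ (-ε) > 1/64`. -/
lemma exists_sum_sq_le_diskNorm {t : ℝ} (ht0 : 0 ≤ t) (ht : t < 1) :
    ∃ C : ℝ, 1 ≤ C ∧ ∀ (a : ℕ → ℂ) (K : ℕ),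
      ∑ k ∈ Finset.range K, t ^ (2 * k) * ‖a k‖ ^ 2 ≤ (C * diskNorm K a) ^ 2 := by
  have hs : Summable fun k : ℕ => ((k : ℝ) + 1) ^ 2 * (t ^ 2) ^ k := by
    have ht2 : ‖t ^ 2‖ < 1 := by
      rw [Real.norm_of_nonneg (sq_nonneg t)]
      nlinarith
    have h2 := summable_pow_mul_geometric_of_norm_lt_one 2 ht2
    have h1 := summable_pow_mul_geometric_of_norm_lt_one 1 ht2
    have h0 := summable_pow_mul_geometric_of_norm_lt_one 0 ht2
    refine ((h2.add (h1.mul_left 2)).add h0).congr fun k => ?_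
    ring
  set B := ∑' k : ℕ, ((k : ℝ) + 1) ^ 2 * (t ^ 2) ^ k
  have hB : 0 ≤ B := tsum_nonneg fun k => by positivity
  -- Adding `1` secures both `1 ≤ C` and `B ≤ C ^ 2`.
  refine ⟨B + 1, by linarith, fun a K => ?_⟩
  have hM := diskNorm_nonneg K a
  calc _ ≤ ∑ k ∈ Finset.range K, ((k : ℝ) + 1) ^ 2 * (t ^ 2) ^ k * diskNorm K a ^ 2 := by
        refine Finset.sum_le_sum fun k hk => ?_
        have h1 := norm_coeff_le_diskNorm a (Finset.mem_range.1 hk)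
        calc t ^ (2 * k) * ‖a k‖ ^ 2 ≤ t ^ (2 * k) * (((k : ℝ) + 1) * diskNorm K a) ^ 2 := by
              gcongr
          _ = _ := by rw [pow_mul]; ring
    _ ≤ B * diskNorm K a ^ 2 := by
        rw [← Finset.sum_mul]
        gcongr
        exact hs.sum_le_tsum _ fun k _ => by positivity
    _ ≤ _ := by
        rw [mul_pow]
        gcongr
        nlinarith

/-! ### Tensorization over finitely many primes -/

/-- Minkowski's inequality for a finite `ℓ ^ 2` sum of integrals. -/
lemma sum_sq_integral_le_sq_integral_sqrt {Ω : Type*} [MeasurableSpace Ω] {μ : Measure Ω}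
    (s : Finset ℕ) {g : ℕ → Ω → ℝ} (hg : ∀ k, Integrable (g k) μ) :
    ∑ k ∈ s, (∫ x, g k x ∂μ) ^ 2 ≤ (∫ x, √(∑ k ∈ s, g k x ^ 2) ∂μ) ^ 2 := by
  set V : Ω → EuclideanSpace ℝ s := fun x => WithLp.toLp 2 fun k : s => g k x
  have hV : ∀ k : s, Integrable (fun x => V x k) μ := fun k => hg k
  have h1 := norm_integral_le_integral_norm (μ := μ) V
  have h2 : ∀ x, ‖V x‖ = √(∑ k ∈ s, g k x ^ 2) := by
    intro x
    rw [EuclideanSpace.norm_eq]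
    congr 1
    rw [← Finset.sum_coe_sort s]
    exact Finset.sum_congr rfl fun k _ => by simp [V]
  simp only [h2] at h1
  refine le_trans (le_of_eq ?_) (pow_le_pow_left₀ (norm_nonneg _) h1 2)
  rw [EuclideanSpace.norm_sq_eq, ← Finset.sum_coe_sort s]
  refine Finset.sum_congr rfl fun k _ => ?_
  rw [eval_integral_piLp hV k, Real.norm_eq_abs, sq_abs]

/-- The monomial with exponents `e` in the variables of `S`. -/
def partialMonomial (S : Finset Nat.Primes) (e : Nat.Primes → ℕ) (z : Nat.Primes → ℂ) : ℂ :=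
  ∏ q ∈ S, z q ^ e q

lemma measurable_partialMonomial (S : Finset Nat.Primes) (e : Nat.Primes → ℕ) :
    Measurable (partialMonomial S e) := by
  unfold partialMonomial
  fun_prop

lemma integrable_partialMonomial (S : Finset Nat.Primes) (e : Nat.Primes → ℕ) :
    Integrable (partialMonomial S e) polydiskMeasure := by
  refine Integrable.of_bound (measurable_partialMonomial S e).aestronglyMeasurable 1 ?_
  filter_upwards [ae_polydisk ae_mem_disk] with z hz
  rw [partialMonomial, norm_prod]
  refine Finset.prod_le_one (fun _ _ => norm_nonneg _) fun q _ => ?_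
  rw [norm_pow]
  exact pow_le_one₀ (norm_nonneg _) (hz q).le

lemma integrable_sum_partialMonomial {N : Type*} (S : Finset Nat.Primes) (J : Finset N)
    (e : N → Nat.Primes → ℕ) (a : N → ℂ) :
    Integrable (fun z => ∑ n ∈ J, a n * partialMonomial S (e n) z) polydiskMeasure :=
  integrable_finsetSum _ fun n _ => (integrable_partialMonomial S (e n)).const_mul _

lemma partialMonomial_insert_update {S : Finset Nat.Primes} {q : Nat.Primes} (hq : q ∉ S)
    (e : Nat.Primes → ℕ) (z : Nat.Primes → ℂ) (x : ℂ) :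
    partialMonomial (insert q S) e (Function.update z q x) = x ^ e q * partialMonomial S e z := by
  rw [partialMonomial, Finset.prod_insert hq, Function.update_self]
  congr 1
  refine Finset.prod_congr rfl fun r hr => ?_
  rw [Function.update_of_ne (by rintro rfl; exact hq hr)]

/-- Tensorization of one-variable inequalities over finitely many variables. -/
lemma sum_sq_le_integral_partialMonomial {t C : Nat.Primes → ℝ} (ht : ∀ q, 0 ≤ t q)
    (hC : ∀ q, 0 ≤ C q)
    (h : ∀ q (a : ℕ → ℂ) (K : ℕ),
      ∑ k ∈ Finset.range K, t q ^ (2 * k) * ‖a k‖ ^ 2 ≤ (C q * diskNorm K a) ^ 2)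
    {N : Type*} (e : N → Nat.Primes → ℕ) (a : N → ℂ) (S : Finset Nat.Primes) :
    ∀ J : Finset N, (∀ m ∈ J, ∀ n ∈ J, (∀ q ∈ S, e m q = e n q) → m = n) →
    ∑ n ∈ J, (∏ q ∈ S, t q ^ (2 * e n q)) * ‖a n‖ ^ 2 ≤
      ((∏ q ∈ S, C q) *
        ∫ z, ‖∑ n ∈ J, a n * partialMonomial S (e n) z‖ ∂polydiskMeasure) ^ 2 := by
  classical
  induction S using Finset.induction_on with
  | empty =>
    intro J hJ
    rcases J.eq_empty_or_nonempty with rfl | ⟨n, hn⟩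
    · simp
    -- With no variables left, distinct indices can no longer be separated by exponents, so at most
    -- one term remains.
    · have : J = {n} := Finset.eq_singleton_iff_unique_mem.2
        ⟨hn, fun m hm => hJ m hm n hn (by simp)⟩
      subst this
      simp [partialMonomial]
  | insert q S hq ih =>
    intro J hJ
    set K := J.sup (fun n => e n q) + 1
    have hK : ∀ n ∈ J, e n q ∈ Finset.range K := fun n hn =>
      Finset.mem_range.2 (Nat.lt_succ_of_le (Finset.le_sup (f := fun n => e n q) hn))
    set J' : ℕ → Finset N := fun k => J.filter fun n => e n q = k
    set g : ℕ → (Nat.Primes → ℂ) → ℂ := fun k z => ∑ n ∈ J' k, a n * partialMonomial S (e n) z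
    set F : (Nat.Primes → ℂ) → ℂ := fun z => ∑ n ∈ J, a n * partialMonomial (insert q S) (e n) z
    have hgint : ∀ k, Integrable (g k) polydiskMeasure := fun k =>
      integrable_sum_partialMonomial S (J' k) e a
    have hFint : Integrable F polydiskMeasure :=
      integrable_sum_partialMonomial (insert q S) J e a
    -- Grouping by the exponent of `q` gives a polynomial in the new variable whose coefficients `g
    -- k` are polynomials in the variables of `S`.
    have hF : ∀ z x, F (Function.update z q x) = ∑ k ∈ Finset.range K, g k z * x ^ k := by
      intro z x
      simp only [F, g, partialMonomial_insert_update hq]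
      rw [← Finset.sum_fiberwise_of_maps_to hK]
      refine Finset.sum_congr rfl fun k _ => ?_
      rw [Finset.sum_mul]
      refine Finset.sum_congr rfl fun n hn => ?_
      rw [(Finset.mem_filter.1 hn).2]
      ring
    have hnorm : ∫ z, diskNorm K (fun k => g k z) ∂polydiskMeasure =
        ∫ z, ‖F z‖ ∂polydiskMeasure := by
      rw [← integral_update q hFint.norm]
      refine integral_congr_ae (Eventually.of_forall fun z => ?_)
      simp only [hF, diskNorm]
    have hnint : Integrable (fun z => diskNorm K (fun k => g k z)) polydiskMeasure := by
      have := ((measurePreserving_update q).integrable_comp_of_integrable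
        hFint.norm).integral_prod_left
      refine this.congr (Eventually.of_forall fun z => ?_)
      simp only [Function.comp_apply, hF, diskNorm]
    have hPS : 0 ≤ ∏ r ∈ S, C r := Finset.prod_nonneg fun r _ => hC r
    calc ∑ n ∈ J, (∏ r ∈ insert q S, t r ^ (2 * e n r)) * ‖a n‖ ^ 2
        = ∑ k ∈ Finset.range K, t q ^ (2 * k) *
            ∑ n ∈ J' k, (∏ r ∈ S, t r ^ (2 * e n r)) * ‖a n‖ ^ 2 := by
          rw [← Finset.sum_fiberwise_of_maps_to hK]
          refine Finset.sum_congr rfl fun k _ => ?_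
          rw [Finset.mul_sum]
          refine Finset.sum_congr rfl fun n hn => ?_
          rw [Finset.prod_insert hq, (Finset.mem_filter.1 hn).2]
          ring
      -- The induction hypothesis bounds each coefficient polynomial. Indices in one group share the
      -- exponent of `q`, so those of `S` still separate them.
      _ ≤ ∑ k ∈ Finset.range K, t q ^ (2 * k) *
            ((∏ r ∈ S, C r) * ∫ z, ‖g k z‖ ∂polydiskMeasure) ^ 2 := by
          refine Finset.sum_le_sum fun k _ => mul_le_mul_of_nonneg_left ?_ (pow_nonneg (ht q) _)
          refine ih (J' k) fun m hm n hn hmn => ?_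
          have hm' := Finset.mem_filter.1 hm
          have hn' := Finset.mem_filter.1 hn
          refine hJ m hm'.1 n hn'.1 fun r hr => ?_
          rcases Finset.mem_insert.1 hr with rfl | hr
          · rw [hm'.2, hn'.2]
          · exact hmn r hr
      _ = (∏ r ∈ S, C r) ^ 2 *
            ∑ k ∈ Finset.range K, (∫ z, t q ^ k * ‖g k z‖ ∂polydiskMeasure) ^ 2 := by
          rw [Finset.mul_sum]
          refine Finset.sum_congr rfl fun k _ => ?_
          rw [integral_const_mul]
          ring
      -- Minkowski moves the `ℓ ^ 2` norm inside the integral, where the one-variable inequality at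
      -- `q` applies for each fixed `z`.
      _ ≤ (∏ r ∈ S, C r) ^ 2 *
            (∫ z, √(∑ k ∈ Finset.range K, (t q ^ k * ‖g k z‖) ^ 2) ∂polydiskMeasure) ^ 2 := by
          gcongr
          exact sum_sq_integral_le_sq_integral_sqrt _ fun k => (hgint k).norm.const_mul _
      _ ≤ (∏ r ∈ S, C r) ^ 2 *
            (∫ z, C q * diskNorm K (fun k => g k z) ∂polydiskMeasure) ^ 2 := by
          refine mul_le_mul_of_nonneg_left (pow_le_pow_left₀
            (integral_nonneg fun _ => Real.sqrt_nonneg _) ?_ 2) (sq_nonneg _)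
          refine integral_mono_of_nonneg (Eventually.of_forall fun z => Real.sqrt_nonneg _)
            (hnint.const_mul _) (Eventually.of_forall fun z => ?_)
          refine Real.sqrt_le_iff.2 ⟨mul_nonneg (hC q) (diskNorm_nonneg _ _), ?_⟩
          refine le_trans (le_of_eq ?_) (h q (fun k => g k z) K)
          exact Finset.sum_congr rfl fun k _ => by ring
      _ = _ := by
          rw [integral_const_mul, hnorm, Finset.prod_insert hq]
          ring

/-! ### The weighted `ℓ ^ 2` bound for Dirichlet polynomials -/

/-- The Bohr lift of a Dirichlet polynomial, as a function. -/
def lift {p : ℝ≥0∞} (P : DirichletPoly p) (z : Nat.Primes → ℂ) : ℂ :=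
  ∑ n ∈ (DirichletPoly.toFinsupp p P).support, polyCoeff p n P * monomial n z

lemma monomial_eq_partialMonomial {S : Finset Nat.Primes} {n : ℕ+} (h : primeSupport n ⊆ S) :
    monomial n = partialMonomial S fun q => (n : ℕ).factorization q := by
  ext z
  rw [monomial, partialMonomial]
  refine Finset.prod_subset h fun q _ hq => ?_
  have : (n : ℕ).factorization q = 0 := by
    rw [← Finsupp.notMem_support_iff, Nat.support_factorization]
    exact fun h => hq (Finset.mem_subtype.2 h)
  simp [this]

lemma prod_primeSupport_pow {S : Finset Nat.Primes} {n : ℕ+} (h : primeSupport n ⊆ S) :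
    ∏ q ∈ S, (q : ℕ) ^ (n : ℕ).factorization q = n := by
  conv_rhs => rw [← Nat.prod_factorization_pow_eq_self n.ne_zero]
  rw [Finsupp.prod, Nat.support_factorization]
  rw [← Finset.prod_subtype_of_mem (p := Nat.Prime) (fun q => q ^ (n : ℕ).factorization q)
    fun q hq => Nat.prime_of_mem_primeFactors hq]
  refine (Finset.prod_subset h fun q _ hq => ?_).symm
  have : (n : ℕ).factorization q = 0 := by
    rw [← Finsupp.notMem_support_iff, Nat.support_factorization]
    exact fun h => hq (Finset.mem_subtype.2 h)
  simp [this]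

lemma eq_of_factorization_eq_on {S : Finset Nat.Primes} {m n : ℕ+} (hm : primeSupport m ⊆ S)
    (hn : primeSupport n ⊆ S)
    (h : ∀ q ∈ S, (m : ℕ).factorization q = (n : ℕ).factorization q) : m = n := by
  apply PNat.eq
  rw [← prod_primeSupport_pow hm, ← prod_primeSupport_pow hn]
  exact Finset.prod_congr rfl fun q hq => by rw [h q hq]

/-- The primes that divide an index of the support of `P`. -/
def polyPrimes {p : ℝ≥0∞} (P : DirichletPoly p) : Finset Nat.Primes := by
  classical exact (DirichletPoly.toFinsupp p P).support.biUnion primeSupport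

lemma primeSupport_subset_polyPrimes {p : ℝ≥0∞} (P : DirichletPoly p) {n : ℕ+}
    (hn : n ∈ (DirichletPoly.toFinsupp p P).support) : primeSupport n ⊆ polyPrimes P := by
  classical exact Finset.subset_biUnion_of_mem primeSupport hn

/-- For every `ε > 0` the map `∑ a_n n ^ (-s) ↦ (n ^ (-ε) a_n)` is bounded from the `L ^ 1` norm of
the Bohr lift to `ℓ ^ 2`. -/
lemma exists_sum_rpow_mul_sq_le (p : ℝ≥0∞) {ε : ℝ} (hε : 0 < ε) :
    ∃ C : ℝ, 0 ≤ C ∧ ∀ P : DirichletPoly p,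
      ∑ n ∈ (DirichletPoly.toFinsupp p P).support,
        (((n : ℕ) : ℝ) ^ (-ε) * ‖polyCoeff p n P‖) ^ 2 ≤
      (C * ∫ z, ‖lift P z‖ ∂polydiskMeasure) ^ 2 := by
  classical
  set t : Nat.Primes → ℝ := fun q => ((q : ℕ) : ℝ) ^ (-ε)
  have ht0 : ∀ q, 0 ≤ t q := fun q => by positivity
  have ht1 : ∀ q, t q < 1 := fun q =>
    Real.rpow_lt_one_of_one_lt_of_neg (by exact_mod_cast q.2.one_lt) (by linarith)
  choose C' hC'1 hC' using fun q => exists_sum_sq_le_diskNorm (ht0 q) (ht1 q)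
  -- Since `q ^ (-ε) → 0`, only finitely many primes escape the contractive case. All other
  -- constants are `1`, which bounds their products independently of the polynomial.
  have hfin : {q : Nat.Primes | ¬ t q ≤ 1 / 64}.Finite := by
    have h1 : Tendsto (fun q : Nat.Primes => t q) cofinite (𝓝 0) := by
      have hc : Tendsto (fun q : Nat.Primes => (q : ℕ)) cofinite atTop :=
        Nat.cofinite_eq_atTop ▸ (Subtype.val_injective (p := Nat.Prime)).tendsto_cofinite
      exact (tendsto_rpow_neg_atTop hε).comp (tendsto_natCast_atTop_atTop.comp hc)
    have := h1.eventually (ge_mem_nhds (show (0 : ℝ) < 1 / 64 by norm_num))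
    exact this
  set C : Nat.Primes → ℝ := fun q => if t q ≤ 1 / 64 then 1 else C' q
  have hC1 : ∀ q, 1 ≤ C q := fun q => by
    simp only [C]; split_ifs; exacts [le_rfl, hC'1 q]
  have hC : ∀ q (a : ℕ → ℂ) (K : ℕ),
      ∑ k ∈ Finset.range K, t q ^ (2 * k) * ‖a k‖ ^ 2 ≤ (C q * diskNorm K a) ^ 2 := by
    intro q a K
    simp only [C]
    split_ifs with h
    · rw [one_mul]; exact sum_sq_le_diskNorm (ht0 q) h a K
    · exact hC' q a K
  have hprod : ∀ S : Finset Nat.Primes, ∏ q ∈ S, C q ≤ ∏ q ∈ hfin.toFinset, C q := by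
    intro S
    calc ∏ q ∈ S, C q = ∏ q ∈ S.filter (fun q => ¬ t q ≤ 1 / 64), C q := by
          rw [Finset.prod_filter]
          refine Finset.prod_congr rfl fun q _ => ?_
          by_cases h : t q ≤ 1 / 64 <;> simp only [C, h, not_true, not_false_eq_true, if_true,
            if_false]
      _ ≤ _ := by
          refine Finset.prod_le_prod_of_subset_of_one_le (fun q hq => ?_)
            (fun q _ => by linarith [hC1 q]) fun q _ _ => hC1 q
          exact hfin.mem_toFinset.2 (Finset.mem_filter.1 hq).2
  refine ⟨∏ q ∈ hfin.toFinset, C q, Finset.prod_nonneg fun q _ => by linarith [hC1 q],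
    fun P => ?_⟩
  have key := sum_sq_le_integral_partialMonomial ht0 (fun q => by linarith [hC1 q]) hC
    (fun (n : ℕ+) (q : Nat.Primes) => (n : ℕ).factorization q) (fun n => polyCoeff p n P)
    (polyPrimes P) (DirichletPoly.toFinsupp p P).support (fun m hm n hn hmn =>
      eq_of_factorization_eq_on (primeSupport_subset_polyPrimes P hm)
        (primeSupport_subset_polyPrimes P hn) hmn)
  have hl : ∀ z, ∑ n ∈ (DirichletPoly.toFinsupp p P).support, polyCoeff p n P *
      partialMonomial (polyPrimes P) (fun q => (n : ℕ).factorization q) z = lift P z := by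
    intro z
    refine Finset.sum_congr rfl fun n hn => ?_
    rw [monomial_eq_partialMonomial (primeSupport_subset_polyPrimes P hn)]
  simp only [hl] at key
  refine le_trans (le_of_eq (Finset.sum_congr rfl fun n hn => ?_)) (key.trans ?_)
  · have : ((n : ℕ) : ℝ) ^ (-ε) = ∏ q ∈ polyPrimes P, t q ^ (n : ℕ).factorization q := by
      conv_lhs => rw [← prod_primeSupport_pow (primeSupport_subset_polyPrimes P hn)]
      push_cast
      rw [← Real.finsetProd_rpow _ _ fun q _ => by positivity]
      refine Finset.prod_congr rfl fun q _ => ?_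
      rw [← Real.rpow_natCast_mul (by positivity), mul_comm, Real.rpow_mul_natCast (by positivity)]
    rw [mul_pow, this, ← Finset.prod_pow]
    congr 1
    exact Finset.prod_congr rfl fun q _ => by rw [← pow_mul, mul_comm]
  · have h0 : 0 ≤ ∫ z, ‖lift P z‖ ∂polydiskMeasure := integral_nonneg fun _ => norm_nonneg _
    have := Finset.prod_nonneg (s := polyPrimes P) fun q _ => (zero_le_one.trans (hC1 q))
    exact pow_le_pow_left₀ (mul_nonneg this h0) (mul_le_mul_of_nonneg_right (hprod _) h0) 2

/-! ### Hölder's inequality and extremal kernels -/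

lemma integrable_prod_coordinates {𝕜 : Type*} [RCLike 𝕜] (S : Finset Nat.Primes)
    {f : Nat.Primes → ℂ → 𝕜} (hf : ∀ q, ContinuousOn (f q) (Metric.closedBall 0 1)) :
    Integrable (fun z => ∏ q ∈ S, f q (z q)) polydiskMeasure := by
  choose C hC using fun q => (isCompact_closedBall (0 : ℂ) 1).exists_bound_of_continuousOn (hf q)
  have hm : AEStronglyMeasurable (fun z : Nat.Primes → ℂ => ∏ q ∈ S, f q (z q))
      polydiskMeasure := by
    refine Finset.aestronglyMeasurable_fun_prod _ fun q _ => ?_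
    exact (integrable_diskMeasure_of_continuousOn (hf q)).1.comp_quasiMeasurePreserving
      (measurePreserving_eval_infinitePi (fun _ : Nat.Primes => diskMeasure)
        q).quasiMeasurePreserving
  refine Integrable.of_bound hm (∏ q ∈ S, C q) ?_
  filter_upwards [ae_polydisk ae_mem_closedBall] with z hz
  rw [norm_prod]
  exact Finset.prod_le_prod (fun _ _ => norm_nonneg _) fun q _ => hC q _ (hz q)

/-- This form of Hölder allows `b = 0`, so `p = 1` needs no separate treatment. -/
lemma integral_rpow_mul_rpow_le {Ω : Type*} [MeasurableSpace Ω] {μ : Measure Ω} {F G : Ω → ℝ}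
    (hF : Integrable F μ) (hG : Integrable G μ) (hF0 : ∀ x, 0 ≤ F x) (hG0 : ∀ x, 0 ≤ G x)
    {a b : ℝ} (ha : 0 ≤ a) (hb : 0 ≤ b) (hab : a + b = 1) :
    ∫ x, F x ^ a * G x ^ b ∂μ ≤ (∫ x, F x ∂μ) ^ a * (∫ x, G x ∂μ) ^ b := by
  have hm : AEStronglyMeasurable (fun x => F x ^ a * G x ^ b) μ :=
    ((hF.1.aemeasurable.pow_const a).mul (hG.1.aemeasurable.pow_const b)).aestronglyMeasurable
  rw [integral_eq_lintegral_of_nonneg_ae (Eventually.of_forall fun x =>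
      mul_nonneg (Real.rpow_nonneg (hF0 x) _) (Real.rpow_nonneg (hG0 x) _)) hm,
    integral_eq_lintegral_of_nonneg_ae (Eventually.of_forall hF0) hF.1,
    integral_eq_lintegral_of_nonneg_ae (Eventually.of_forall hG0) hG.1]
  have h := ENNReal.lintegral_mul_norm_pow_le (μ := μ) (f := fun x => ENNReal.ofReal (F x))
    (g := fun x => ENNReal.ofReal (G x)) hF.1.aemeasurable.ennreal_ofReal
    hG.1.aemeasurable.ennreal_ofReal ha hb hab
  have e : ∀ x, ENNReal.ofReal (F x ^ a * G x ^ b) =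
      ENNReal.ofReal (F x) ^ a * ENNReal.ofReal (G x) ^ b := fun x => by
    rw [ENNReal.ofReal_mul (Real.rpow_nonneg (hF0 x) _),
      ENNReal.ofReal_rpow_of_nonneg (hF0 x) ha, ENNReal.ofReal_rpow_of_nonneg (hG0 x) hb]
  simp only [e]
  rw [ENNReal.toReal_rpow, ENNReal.toReal_rpow, ← ENNReal.toReal_mul]
  refine ENNReal.toReal_mono (ENNReal.mul_ne_top ?_ ?_) h
  · exact ENNReal.rpow_ne_top_of_nonneg ha hF.lintegral_lt_top.ne
  · exact ENNReal.rpow_ne_top_of_nonneg hb hG.lintegral_lt_top.ne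

section disk

variable {ζ : ℂ}

/-- The radius exceeds `1`, yet times `‖ζ‖` it stays below `1`, also for `ζ = 0`. So `1 - ζ̄ x` has
positive real part and its principal powers are holomorphic past the closed disk. -/
lemma one_sub_conj_mul_mem_slitPlane (hζ : ‖ζ‖ < 1) {x : ℂ} (hx : x ∈ Metric.ball (0 : ℂ) (2 / (1 + ‖ζ‖))) :
    1 - conj ζ * x ∈ Complex.slitPlane := by
  refine Or.inl ?_
  have h0 := norm_nonneg ζ
  have h1 : ‖conj ζ * x‖ < 1 := by
    rw [norm_mul, RCLike.norm_conj]
    have hx' : ‖x‖ < 2 / (1 + ‖ζ‖) := by simpa using hx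
    calc ‖ζ‖ * ‖x‖ ≤ ‖ζ‖ * (2 / (1 + ‖ζ‖)) := by gcongr
      _ < 1 := by
        rw [mul_div_assoc', div_lt_one (by positivity)]
        linarith
  have := (Complex.re_le_norm (conj ζ * x)).trans_lt h1
  rw [Complex.sub_re, Complex.one_re]
  linarith

lemma one_lt_two_div_one_add_norm (hζ : ‖ζ‖ < 1) : 1 < 2 / (1 + ‖ζ‖) := by
  rw [one_lt_div (by positivity)]
  linarith

lemma differentiableOn_cpow_one_sub (hζ : ‖ζ‖ < 1) (s : ℂ) :
    DifferentiableOn ℂ (fun x => (1 - conj ζ * x) ^ s) (Metric.ball 0 (2 / (1 + ‖ζ‖))) :=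
  DifferentiableOn.cpow_const (by fun_prop) fun _ hx => one_sub_conj_mul_mem_slitPlane hζ hx

lemma closedBall_subset_ball_two_div (hζ : ‖ζ‖ < 1) :
    Metric.closedBall (0 : ℂ) 1 ⊆ Metric.ball 0 (2 / (1 + ‖ζ‖)) :=
  Metric.closedBall_subset_ball (one_lt_two_div_one_add_norm hζ)

lemma one_sub_norm_sq_pos (hζ : ‖ζ‖ < 1) : 0 < 1 - ‖ζ‖ ^ 2 := by
  nlinarith [norm_nonneg ζ]

lemma norm_one_sub_conj_mul_pos (hζ : ‖ζ‖ < 1) {x : ℂ} (hx : x ∈ Metric.closedBall (0 : ℂ) 1) :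
    0 < ‖1 - conj ζ * x‖ :=
  norm_pos_iff.2 (Complex.slitPlane_ne_zero
    (one_sub_conj_mul_mem_slitPlane hζ (closedBall_subset_ball_two_div hζ hx)))

lemma cpow_one_sub_self (hζ : ‖ζ‖ < 1) (s : ℝ) :
    (1 - conj ζ * ζ) ^ (s : ℂ) = (((1 - ‖ζ‖ ^ 2) ^ s : ℝ) : ℂ) := by
  rw [Complex.ofReal_cpow (one_sub_norm_sq_pos hζ).le, Complex.conj_mul']
  push_cast
  rfl

lemma continuousOn_norm_one_sub_rpow (hζ : ‖ζ‖ < 1) (s : ℝ) :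
    ContinuousOn (fun x => ‖1 - conj ζ * x‖ ^ s) (Metric.closedBall 0 1) :=
  ContinuousOn.rpow_const (by fun_prop) fun _ hx => Or.inl (norm_one_sub_conj_mul_pos hζ hx).ne'

lemma norm_one_sub_mul_conj (x : ℂ) : ‖1 - ζ * conj x‖ = ‖1 - conj ζ * x‖ := by
  rw [← RCLike.norm_conj]
  simp

/-- Apply the reproducing formula to `(1 - ζ̄ x) ^ (-2)`: its product with the kernel, which is its
conjugate, is the integrand. -/
lemma integral_norm_one_sub_rpow (hζ : ‖ζ‖ < 1) :
    ∫ x, ‖1 - conj ζ * x‖ ^ (-4 : ℝ) ∂diskMeasure = (1 - ‖ζ‖ ^ 2) ^ (-2 : ℝ) := by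
  have h := integral_mul_bergmanKernel hζ (one_lt_two_div_one_add_norm hζ)
    (differentiableOn_cpow_one_sub hζ ((-2 : ℝ) : ℂ))
  rw [cpow_one_sub_self hζ] at h
  have h2 : ∫ x, (1 - conj ζ * x) ^ ((-2 : ℝ) : ℂ) * ((1 - ζ * conj x) ^ 2)⁻¹ ∂diskMeasure =
      ∫ x, ((‖1 - conj ζ * x‖ ^ (-4 : ℝ) : ℝ) : ℂ) ∂diskMeasure := by
    refine integral_congr_ae ?_
    filter_upwards [ae_mem_closedBall] with x hx
    have hpos := norm_one_sub_conj_mul_pos hζ hx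
    have e1 : (1 - conj ζ * x) ^ ((-2 : ℝ) : ℂ) = ((1 - conj ζ * x) ^ 2)⁻¹ := by
      push_cast
      rw [Complex.cpow_neg]
      norm_cast
    have e2 : 1 - ζ * conj x = conj (1 - conj ζ * x) := by simp
    rw [e1, e2, ← mul_inv, ← mul_pow, Complex.mul_conj', Real.rpow_neg hpos.le]
    norm_cast
    rw [← pow_mul]
  rw [h2, integral_complex_ofReal] at h
  exact_mod_cast h

/-- The kernel that reproduces the value at `ζ` of a polynomial and is extremal in the dual of the
Bergman space `A ^ P` of the disk. -/
def extremalKernel (P : ℝ) (ζ x : ℂ) : ℂ :=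
  ((1 - ‖ζ‖ ^ 2) ^ (2 - 4 / P) : ℝ) *
    ((1 - conj ζ * x) ^ ((4 / P - 2 : ℝ) : ℂ) * ((1 - ζ * conj x) ^ 2)⁻¹)

lemma continuousOn_extremalKernel (hζ : ‖ζ‖ < 1) (P : ℝ) :
    ContinuousOn (extremalKernel P ζ) (Metric.closedBall 0 1) :=
  continuousOn_const.mul (((differentiableOn_cpow_one_sub hζ _).continuousOn.mono
    (closedBall_subset_ball_two_div hζ)).mul (continuousOn_bergmanKernel hζ))

/-- The holomorphic power in the kernel is reproduced along with `x ^ j`; its value at `ζ` cancels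
the normalizing prefactor. -/
lemma integral_pow_mul_extremalKernel (hζ : ‖ζ‖ < 1) (P : ℝ) (j : ℕ) :
    ∫ x, x ^ j * extremalKernel P ζ x ∂diskMeasure = ζ ^ j := by
  have h := integral_mul_bergmanKernel hζ (one_lt_two_div_one_add_norm hζ)
    ((differentiable_pow j).differentiableOn.mul
      (differentiableOn_cpow_one_sub hζ ((4 / P - 2 : ℝ) : ℂ)))
  have e : ∀ x : ℂ, x ^ j * extremalKernel P ζ x = ((1 - ‖ζ‖ ^ 2) ^ (2 - 4 / P) : ℝ) *
      (((fun x : ℂ => x ^ j) * fun x : ℂ => (1 - conj ζ * x) ^ ((4 / P - 2 : ℝ) : ℂ)) x *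
        ((1 - ζ * conj x) ^ 2)⁻¹) := by
    intro x
    simp only [extremalKernel, Pi.mul_apply]
    ring
  simp only [e]
  rw [integral_const_mul, h, Pi.mul_apply, cpow_one_sub_self hζ, mul_left_comm, ← Complex.ofReal_mul,
    ← Real.rpow_add (one_sub_norm_sq_pos hζ)]
  simp

/-- The exponents combine as `(4/P - 2) - 2 = -4 (1 - 1/P)`, so Hölder with exponent `1 - 1/P` only
meets the known integral of `|1 - ζ̄ x| ^ (-4)`. -/
lemma norm_extremalKernel (hζ : ‖ζ‖ < 1) {P : ℝ} (hP : 1 ≤ P) {x : ℂ} (hx : x ∈ Metric.closedBall (0 : ℂ) 1) :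
    ‖extremalKernel P ζ x‖ =
      (1 - ‖ζ‖ ^ 2) ^ (2 - 4 / P) * (‖1 - conj ζ * x‖ ^ (-4 : ℝ)) ^ (1 - 1 / P) := by
  have hpos := norm_one_sub_conj_mul_pos hζ hx
  have h2 : (‖1 - conj ζ * x‖ ^ 2)⁻¹ = ‖1 - conj ζ * x‖ ^ (-2 : ℝ) := by
    rw [Real.rpow_neg hpos.le]
    norm_cast
  rw [extremalKernel, norm_mul, norm_mul, norm_inv, norm_pow, norm_one_sub_mul_conj,
    Complex.norm_cpow_real, Complex.norm_real,
    Real.norm_of_nonneg (Real.rpow_nonneg (one_sub_norm_sq_pos hζ).le _), h2,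
    ← Real.rpow_add hpos, ← Real.rpow_mul hpos.le]
  congr 2
  field_simp
  ring

end disk

/-! ### The norm of the evaluation functionals -/

section evaluation

variable {p : ℝ≥0∞}

lemma memLp_lift (P : DirichletPoly p) : MemLp (lift P) p polydiskMeasure :=
  (memLp_congr_ae (bohrLift_coe p P)).1 (Lp.memLp _)

lemma integral_lift_mul_extremalKernel (P : DirichletPoly p) (r : ℝ) {ζ : Nat.Primes → ℂ}
    (hζ : ∀ q, ‖ζ q‖ < 1) :
    ∫ z, lift P z * ∏ q ∈ polyPrimes P, extremalKernel r (ζ q) (z q) ∂polydiskMeasure =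
      lift P ζ := by
  have e : ∀ z, lift P z * ∏ q ∈ polyPrimes P, extremalKernel r (ζ q) (z q) =
      ∑ n ∈ (DirichletPoly.toFinsupp p P).support, polyCoeff p n P *
        ∏ q ∈ polyPrimes P,
          (z q ^ (n : ℕ).factorization q * extremalKernel r (ζ q) (z q)) := by
    intro z
    rw [lift, Finset.sum_mul]
    refine Finset.sum_congr rfl fun n hn => ?_
    rw [monomial_eq_partialMonomial (primeSupport_subset_polyPrimes P hn), partialMonomial,
      Finset.prod_mul_distrib, mul_assoc]
  have hc : ∀ (n : ℕ+) (q : Nat.Primes), ContinuousOn (fun x : ℂ =>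
      x ^ (n : ℕ).factorization q * extremalKernel r (ζ q) x) (Metric.closedBall 0 1) :=
    fun n q => (continuousOn_id.pow _).mul (continuousOn_extremalKernel (hζ q) r)
  simp only [e]
  rw [integral_finsetSum _ fun n _ =>
    (integrable_prod_coordinates (polyPrimes P) (hc n)).const_mul _, lift]
  refine Finset.sum_congr rfl fun n hn => ?_
  rw [integral_const_mul, integral_prod_coordinates (polyPrimes P)
    (fun q => (integrable_diskMeasure_of_continuousOn (hc n q)).1),
    monomial_eq_partialMonomial (primeSupport_subset_polyPrimes P hn), partialMonomial]
  congr 1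
  exact Finset.prod_congr rfl fun q _ => integral_pow_mul_extremalKernel (hζ q) r _

/-- Lifts form an algebra, because monomials are multiplicative in `n`, and it contains every
coordinate `z_q`, the monomial of the prime `q`. Products of one-variable polynomials are therefore
available as test functions. -/
lemma exists_lift_eq_prod (S : Finset Nat.Primes) (m : ℕ) (b : Nat.Primes → ℕ → ℂ) :
    ∃ P : DirichletPoly p, ∀ z,
      lift P z = ∏ q ∈ S, ∑ k ∈ Finset.range m, b q k * z q ^ k := by
  have hmono : ∀ m n : ℕ+, monomial (m * n) = monomial m * monomial n := by
    classical
    intro m n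
    set T := primeSupport m ∪ primeSupport n ∪ primeSupport (m * n)
    rw [monomial_eq_partialMonomial (S := T) Finset.subset_union_right,
      monomial_eq_partialMonomial (S := T) (Finset.subset_union_left.trans
        Finset.subset_union_left),
      monomial_eq_partialMonomial (S := T) (Finset.subset_union_right.trans
        Finset.subset_union_left)]
    ext z
    simp only [partialMonomial, Pi.mul_apply, ← Finset.prod_mul_distrib, ← pow_add, PNat.mul_coe,
      Nat.factorization_mul m.ne_zero n.ne_zero, Finsupp.add_apply]
  have hone : monomial 1 = 1 := by
    ext z
    exact Finset.prod_eq_one fun q _ => by simp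
  set A : Subalgebra ℂ ((Nat.Primes → ℂ) → ℂ) :=
    (Submodule.span ℂ (Set.range monomial)).toSubalgebra
      (Submodule.subset_span ⟨1, hone⟩) (by
        intro f g hf hg
        have h := Submodule.mul_mem_mul hf hg
        rw [Submodule.span_mul_span] at h
        refine Submodule.span_mono ?_ h
        rintro _ ⟨_, ⟨m, rfl⟩, _, ⟨n, rfl⟩, rfl⟩
        exact ⟨m * n, hmono m n⟩)
  have hcoord : ∀ q : Nat.Primes, (fun z : Nat.Primes → ℂ => z q) ∈ A := by
    intro q
    refine Submodule.subset_span ⟨⟨q, q.2.pos⟩, ?_⟩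
    have hs : primeSupport ⟨q, q.2.pos⟩ ⊆ {q} := by
      intro r hr
      have := Finset.mem_subtype.1 hr
      simp only [PNat.mk_coe, q.2.primeFactors, Finset.mem_singleton] at this
      exact Finset.mem_singleton.2 (Subtype.ext this)
    rw [monomial_eq_partialMonomial hs]
    ext z
    simp [partialMonomial, q.2.factorization]
  have hA : (fun z : Nat.Primes → ℂ => ∏ q ∈ S, ∑ k ∈ Finset.range m, b q k * z q ^ k) ∈ A := by
    have : (fun z : Nat.Primes → ℂ => ∏ q ∈ S, ∑ k ∈ Finset.range m, b q k * z q ^ k) =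
        ∏ q ∈ S, ∑ k ∈ Finset.range m, b q k • (fun z : Nat.Primes → ℂ => z q) ^ k := by
      ext z
      simp
    rw [this]
    exact Subalgebra.prod_mem _ fun q _ => Subalgebra.sum_mem _ fun k _ =>
      Subalgebra.smul_mem _ (Subalgebra.pow_mem _ (hcoord q) k) _
  have hA' : (fun z : Nat.Primes → ℂ => ∏ q ∈ S, ∑ k ∈ Finset.range m, b q k * z q ^ k) ∈
      Submodule.span ℂ (Set.range monomial) := hA
  obtain ⟨c, hc⟩ := (Finsupp.mem_span_range_iff_exists_finsupp).1 hA'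
  refine ⟨(DirichletPoly.toFinsupp p).symm c, fun z => ?_⟩
  have := congrFun hc z
  rw [← this]
  simp [lift, polyCoeff, Finsupp.sum]

variable [Fact (1 ≤ p)]

lemma norm_eq_eLpNorm_lift (P : DirichletPoly p) :
    ‖P‖ = (eLpNorm (lift P) p polydiskMeasure).toReal := by
  rw [norm_def, Lp.norm_def, eLpNorm_congr_ae (bohrLift_coe p P)]
  rfl

lemma integral_norm_lift_le (P : DirichletPoly p) :
    ∫ z, ‖lift P z‖ ∂polydiskMeasure ≤ ‖P‖ := by
  rw [integral_norm_eq_lintegral_enorm (memLp_lift P).1, ← eLpNorm_one_eq_lintegral_enorm,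
    norm_eq_eLpNorm_lift]
  exact ENNReal.toReal_mono (memLp_lift P).2.ne
    (eLpNorm_le_eLpNorm_of_exponent_le Fact.out (memLp_lift P).1)

lemma one_le_toReal (hp : p ≠ ⊤) : 1 ≤ p.toReal := by
  have : (1 : ℝ≥0∞) ≤ p := Fact.out
  simpa using ENNReal.toReal_mono hp this

lemma norm_eq_integral_rpow (hp : p ≠ ⊤) (P : DirichletPoly p) :
    ‖P‖ = (∫ z, ‖lift P z‖ ^ p.toReal ∂polydiskMeasure) ^ (1 / p.toReal) := by
  have h0 : p ≠ 0 := (zero_lt_one.trans_le (Fact.out : (1 : ℝ≥0∞) ≤ p)).ne'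
  rw [norm_eq_eLpNorm_lift, (memLp_lift P).eLpNorm_eq_integral_rpow_norm h0 hp, one_div,
    ENNReal.toReal_ofReal]
  exact Real.rpow_nonneg (integral_nonneg fun _ => Real.rpow_nonneg (norm_nonneg _) _) _

/-- Reproduce the value by a product of extremal kernels and apply Hölder. The exponent per prime is
`(2 - 4/r) - 2 (1 - 1/r) = -2/r`. -/
lemma norm_lift_le (hp : p ≠ ⊤) (P : DirichletPoly p) {ζ : Nat.Primes → ℂ}
    (hζ : ∀ q, ‖ζ q‖ < 1) :
    ‖lift P ζ‖ ≤ (∏ q ∈ polyPrimes P, (1 - ‖ζ q‖ ^ 2) ^ (-2 / p.toReal)) * ‖P‖ := by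
  set r := p.toReal
  have hr : 1 ≤ r := one_le_toReal hp
  have hr0 : 0 < r := by linarith
  set S := polyPrimes P
  set W : (Nat.Primes → ℂ) → ℝ := fun z => ∏ q ∈ S, ‖1 - conj (ζ q) * z q‖ ^ (-4 : ℝ)
  have hWi : Integrable W polydiskMeasure :=
    integrable_prod_coordinates S fun q => continuousOn_norm_one_sub_rpow (hζ q) (-4)
  have hW : ∫ z, W z ∂polydiskMeasure = ∏ q ∈ S, (1 - ‖ζ q‖ ^ 2) ^ (-2 : ℝ) := by
    rw [integral_prod_coordinates S (f := fun q x => ‖1 - conj (ζ q) * x‖ ^ (-4 : ℝ)) fun q =>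
      (integrable_diskMeasure_of_continuousOn (continuousOn_norm_one_sub_rpow (hζ q) (-4))).1]
    exact Finset.prod_congr rfl fun q _ => integral_norm_one_sub_rpow (hζ q)
  set c : ℝ := ∏ q ∈ S, (1 - ‖ζ q‖ ^ 2) ^ (2 - 4 / r)
  have hc : 0 ≤ c := Finset.prod_nonneg fun q _ =>
    Real.rpow_nonneg (one_sub_norm_sq_pos (hζ q)).le _
  have hFi : Integrable (fun z => ‖lift P z‖ ^ r) polydiskMeasure :=
    (memLp_lift P).integrable_norm_rpow
      (zero_lt_one.trans_le (Fact.out : (1 : ℝ≥0∞) ≤ p)).ne' hp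
  have hW0 : ∀ z, 0 ≤ W z := fun z =>
    Finset.prod_nonneg fun q _ => Real.rpow_nonneg (norm_nonneg _) _
  have hle : 1 / r ≤ 1 := by rw [div_le_one hr0]; exact hr
  have hH := integral_rpow_mul_rpow_le hFi hWi (fun z => Real.rpow_nonneg (norm_nonneg _) _) hW0
    (a := 1 / r) (b := 1 - 1 / r) (by positivity) (by linarith) (by ring)
  have hpow : ∀ z, (‖lift P z‖ ^ r) ^ (1 / r) = ‖lift P z‖ := fun z => by
    rw [← Real.rpow_mul (norm_nonneg _), mul_one_div_cancel hr0.ne', Real.rpow_one]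
  simp only [hpow] at hH
  calc ‖lift P ζ‖
      = ‖∫ z, lift P z * ∏ q ∈ S, extremalKernel r (ζ q) (z q) ∂polydiskMeasure‖ := by
        rw [integral_lift_mul_extremalKernel P r hζ]
    _ ≤ ∫ z, ‖lift P z * ∏ q ∈ S, extremalKernel r (ζ q) (z q)‖ ∂polydiskMeasure :=
        norm_integral_le_integral_norm _
    _ = ∫ z, c * (‖lift P z‖ * W z ^ (1 - 1 / r)) ∂polydiskMeasure := by
        refine integral_congr_ae ?_
        filter_upwards [ae_polydisk ae_mem_closedBall] with z hz
        rw [norm_mul, norm_prod, Finset.prod_congr rfl fun q _ =>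
          norm_extremalKernel (hζ q) hr (hz q), Finset.prod_mul_distrib,
          Real.finsetProd_rpow _ _ fun q _ => Real.rpow_nonneg (norm_nonneg _) _]
        ring
    _ ≤ c * ((∫ z, ‖lift P z‖ ^ r ∂polydiskMeasure) ^ (1 / r) *
          (∫ z, W z ∂polydiskMeasure) ^ (1 - 1 / r)) := by
        rw [integral_const_mul]
        gcongr
    _ = (c * (∏ q ∈ S, (1 - ‖ζ q‖ ^ 2) ^ (-2 : ℝ)) ^ (1 - 1 / r)) * ‖P‖ := by
        rw [hW, norm_eq_integral_rpow hp]
        ring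
    _ = _ := by
        congr 1
        rw [← Real.finsetProd_rpow _ _ fun q _ =>
          Real.rpow_nonneg (one_sub_norm_sq_pos (hζ q)).le _, ← Finset.prod_mul_distrib]
        refine Finset.prod_congr rfl fun q _ => ?_
        rw [← Real.rpow_mul (one_sub_norm_sq_pos (hζ q)).le,
          ← Real.rpow_add (one_sub_norm_sq_pos (hζ q))]
        congr 1
        field_simp
        ring

/-- A bound for the evaluation at `ζ` of the Bohr lifts is at least the finite partial products of
the expected norm. -/
lemma prod_le_of_norm_lift_le (hp : p ≠ ⊤) {ζ : Nat.Primes → ℂ} (hζ : ∀ q, ‖ζ q‖ < 1) {M : ℝ}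
    (hM : ∀ P : DirichletPoly p, ‖lift P ζ‖ ≤ M * ‖P‖) (S : Finset Nat.Primes) :
    ∏ q ∈ S, (1 - ‖ζ q‖ ^ 2) ^ (-2 / p.toReal) ≤ M := by
  set r := p.toReal
  have hr : 1 ≤ r := one_le_toReal hp
  have hr0 : 0 < r := by linarith
  -- The equality case of Hölder: `|F| ^ r = |1 - ζ̄ x| ^ (-4)`. Its Taylor polynomials are used in
  -- its place.
  set F : Nat.Primes → ℂ → ℂ := fun q x => (1 - conj (ζ q) * x) ^ ((-4 / r : ℝ) : ℂ)
  choose b hb using fun q => exists_taylor_tendstoUniformlyOn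
    (one_lt_two_div_one_add_norm (hζ q)) (differentiableOn_cpow_one_sub (hζ q) ((-4 / r : ℝ) : ℂ))
  choose P hP using fun m => exists_lift_eq_prod (p := p) S m b
  set T : ℕ → Nat.Primes → ℂ → ℂ := fun m q x => ∑ k ∈ Finset.range m, b q k * x ^ k
  have hTc : ∀ m q, Continuous (T m q) := fun m q => by fun_prop
  have hnorm : ∀ m, ‖P m‖ = (∏ q ∈ S, ∫ x, ‖T m q x‖ ^ r ∂diskMeasure) ^ (1 / r) := by
    intro m
    rw [norm_eq_integral_rpow hp, ← integral_prod_coordinates S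
      (f := fun q x => ‖T m q x‖ ^ r) fun q => (integrable_diskMeasure_of_continuousOn
        ((hTc m q).norm.rpow_const fun _ => Or.inr hr0.le).continuousOn).1]
    congr 1
    refine integral_congr_ae (Eventually.of_forall fun z => ?_)
    simp only
    rw [hP, norm_prod, Real.finsetProd_rpow _ _ fun q _ => norm_nonneg _]
  have hlim : ∀ q, Tendsto (fun m => ∫ x, ‖T m q x‖ ^ r ∂diskMeasure) atTop
      (𝓝 ((1 - ‖ζ q‖ ^ 2) ^ (-2 : ℝ))) := by
    intro q
    rw [← integral_norm_one_sub_rpow (hζ q)]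
    have hFc : ContinuousOn (F q) (Metric.closedBall 0 1) :=
      (differentiableOn_cpow_one_sub (hζ q) _).continuousOn.mono
        (closedBall_subset_ball_two_div (hζ q))
    obtain ⟨C, hC⟩ := (isCompact_closedBall (0 : ℂ) 1).exists_bound_of_continuousOn hFc
    refine tendsto_integral_filter_of_dominated_convergence (fun _ => (C + 1) ^ r)
      (Eventually.of_forall fun m => (integrable_diskMeasure_of_continuousOn
        ((hTc m q).norm.rpow_const fun _ => Or.inr hr0.le).continuousOn).1) ?_
      (integrable_const _) ?_
    · filter_upwards [Metric.tendstoUniformlyOn_iff.1 (hb q) 1 one_pos] with m hm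
      filter_upwards [ae_mem_closedBall] with x hx
      rw [Real.norm_of_nonneg (Real.rpow_nonneg (norm_nonneg _) _)]
      have h1 := hm x hx
      rw [dist_comm, dist_eq_norm] at h1
      have h2 := norm_le_norm_add_norm_sub' (T m q x) (F q x)
      have h3 := hC x hx
      refine Real.rpow_le_rpow (norm_nonneg _) ?_ hr0.le
      linarith
    · filter_upwards [ae_mem_closedBall] with x hx
      have h1 := (((hb q).tendsto_at hx).norm).rpow_const (p := r) (Or.inr hr0.le)
      rw [Complex.norm_cpow_real, ← Real.rpow_mul (norm_nonneg _),
        div_mul_cancel₀ _ hr0.ne'] at h1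
      exact h1
  have h1 : Tendsto (fun m => M * ‖P m‖) atTop
      (𝓝 (M * (∏ q ∈ S, (1 - ‖ζ q‖ ^ 2) ^ (-2 : ℝ)) ^ (1 / r))) := by
    simp only [hnorm]
    exact ((tendsto_finsetProd S fun q _ => hlim q).rpow_const
      (Or.inr (by positivity))).const_mul _
  have h2 : Tendsto (fun m => ‖lift (P m) ζ‖) atTop
      (𝓝 (∏ q ∈ S, (1 - ‖ζ q‖ ^ 2) ^ (-4 / r))) := by
    simp only [hP, norm_prod]
    refine tendsto_finsetProd S fun q _ => ?_
    have h := ((hb q).tendsto_at (x := ζ q) (by simpa using (hζ q).le)).norm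
    rwa [cpow_one_sub_self (hζ q), Complex.norm_real,
      Real.norm_of_nonneg (Real.rpow_nonneg (one_sub_norm_sq_pos (hζ q)).le _)] at h
  have h3 := le_of_tendsto_of_tendsto' h2 h1 fun m => hM (P m)
  have h4 : (∏ q ∈ S, (1 - ‖ζ q‖ ^ 2) ^ (-2 : ℝ)) ^ (1 / r) =
      ∏ q ∈ S, (1 - ‖ζ q‖ ^ 2) ^ (-2 / r) := by
    rw [← Real.finsetProd_rpow _ _ fun q _ =>
      Real.rpow_nonneg (one_sub_norm_sq_pos (hζ q)).le _]
    refine Finset.prod_congr rfl fun q _ => ?_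
    rw [← Real.rpow_mul (one_sub_norm_sq_pos (hζ q)).le, mul_one_div]
  -- In the limit the norm is the expected product `X` and the value at `ζ` is `X ^ 2`; then `X ^ 2
  -- ≤ M * X` yields `X ≤ M`.
  have h5 : ∏ q ∈ S, (1 - ‖ζ q‖ ^ 2) ^ (-4 / r) =
      (∏ q ∈ S, (1 - ‖ζ q‖ ^ 2) ^ (-2 / r)) * ∏ q ∈ S, (1 - ‖ζ q‖ ^ 2) ^ (-2 / r) := by
    rw [← Finset.prod_mul_distrib]
    refine Finset.prod_congr rfl fun q _ => ?_
    rw [← Real.rpow_add (one_sub_norm_sq_pos (hζ q))]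
    congr 1
    ring
  rw [h4, h5] at h3
  exact le_of_mul_le_mul_right h3 (Finset.prod_pos fun q _ =>
    Real.rpow_pos_of_pos (one_sub_norm_sq_pos (hζ q)) _)

end evaluation

/-! ### Convergence of the Dirichlet series -/

variable {p : ℝ≥0∞} [Fact (1 ≤ p)]

lemma continuous_coeff (n : ℕ+) : Continuous fun f : BergmanSpace p => coeff f n :=
  (coeffL p n).continuous

/-- The Dirichlet series of the elements of the Bergman space converge absolutely, with a bound, to
the right of `1 / 2`. -/
lemma exists_sum_norm_coeff_mul_rpow_le (p : ℝ≥0∞) [Fact (1 ≤ p)] {σ : ℝ} (hσ : 1 / 2 < σ) :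
    ∃ C : ℝ, 0 ≤ C ∧ ∀ (f : BergmanSpace p) (J : Finset ℕ+),
      ∑ n ∈ J, ‖coeff f n‖ * ((n : ℕ) : ℝ) ^ (-σ) ≤ C * ‖f‖ := by
  classical
  -- Half of the excess damps the coefficients; the other half makes `n ^ (-(1/2 + ε))` square
  -- summable.
  set ε := (σ - 1 / 2) / 2
  have hε : 0 < ε := by simp only [ε]; linarith
  obtain ⟨C, hC0, hC⟩ := exists_sum_rpow_mul_sq_le p hε
  have hs : Summable fun n : ℕ+ => ((n : ℕ) : ℝ) ^ (-(1 + 2 * ε)) :=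
    (Real.summable_nat_rpow.2 (by linarith)).comp_injective PNat.coe_injective
  set Z := ∑' n : ℕ+, ((n : ℕ) : ℝ) ^ (-(1 + 2 * ε))
  have hZ : 0 ≤ Z := tsum_nonneg fun n => by positivity
  refine ⟨C * √Z, by positivity, fun f J => ?_⟩
  induction f using Completion.induction_on with
  | hp =>
    refine isClosed_le (continuous_finsetSum _ fun n _ => ?_) (by fun_prop)
    exact (continuous_coeff n).norm.mul_const _
  | ih P =>
    simp only [coeff, coeffL_coe, Completion.norm_coe]
    set x : ℕ+ → ℝ := fun n => ((n : ℕ) : ℝ) ^ (-ε) * ‖polyCoeff p n P‖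
    set y : ℕ+ → ℝ := fun n => ((n : ℕ) : ℝ) ^ (-(1 / 2 + ε))
    have hxy : ∀ n : ℕ+, ‖polyCoeff p n P‖ * ((n : ℕ) : ℝ) ^ (-σ) = x n * y n := by
      intro n
      have : -σ = -ε + -(1 / 2 + ε) := by simp only [ε]; ring
      rw [this, Real.rpow_add (by exact_mod_cast n.pos)]
      simp only [x, y]
      ring
    have hx : ∑ n ∈ J, x n ^ 2 ≤ (C * ‖P‖) ^ 2 := by
      calc ∑ n ∈ J, x n ^ 2 ≤ ∑ n ∈ J ∪ (DirichletPoly.toFinsupp p P).support, x n ^ 2 :=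
            Finset.sum_le_sum_of_subset_of_nonneg Finset.subset_union_left
              fun _ _ _ => sq_nonneg _
        _ = ∑ n ∈ (DirichletPoly.toFinsupp p P).support, x n ^ 2 := by
            refine (Finset.sum_subset Finset.subset_union_right fun n _ hn => ?_).symm
            have : polyCoeff p n P = 0 := Finsupp.notMem_support_iff.1 hn
            simp [x, this]
        _ ≤ (C * ∫ z, ‖lift P z‖ ∂polydiskMeasure) ^ 2 := hC P
        _ ≤ _ := by
            have : 0 ≤ ∫ z, ‖lift P z‖ ∂polydiskMeasure := integral_nonneg fun _ => norm_nonneg _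
            exact pow_le_pow_left₀ (by positivity)
              (mul_le_mul_of_nonneg_left (integral_norm_lift_le P) hC0) 2
    have hy : ∑ n ∈ J, y n ^ 2 ≤ Z := by
      refine le_trans (le_of_eq (Finset.sum_congr rfl fun n _ => ?_))
        (hs.sum_le_tsum J fun n _ => by positivity)
      rw [← Real.rpow_mul_natCast (by positivity)]
      congr 1
      push_cast
      ring
    simp only [hxy]
    refine (Real.sum_mul_le_sqrt_mul_sqrt J x y).trans ?_
    have h1 : √(∑ n ∈ J, x n ^ 2) ≤ C * ‖P‖ := by
      rw [← Real.sqrt_sq (show 0 ≤ C * ‖P‖ by positivity)]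
      exact Real.sqrt_le_sqrt hx
    calc √(∑ n ∈ J, x n ^ 2) * √(∑ n ∈ J, y n ^ 2) ≤ (C * ‖P‖) * √Z := by
          gcongr
      _ = _ := by ring

lemma norm_mul_natCast_cpow (a : ℂ) (n : ℕ+) (s : ℂ) :
    ‖a * ((n : ℕ) : ℂ) ^ (-s)‖ = ‖a‖ * ((n : ℕ) : ℝ) ^ (-s.re) := by
  rw [norm_mul, Complex.norm_natCast_cpow_of_pos n.pos, Complex.neg_re]

lemma summable_norm_coeff_mul_rpow {σ : ℝ} (hσ : 1 / 2 < σ) (f : BergmanSpace p) :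
    Summable fun n : ℕ+ => ‖coeff f n‖ * ((n : ℕ) : ℝ) ^ (-σ) := by
  obtain ⟨C, -, hC⟩ := exists_sum_norm_coeff_mul_rpow_le p hσ
  exact summable_of_sum_le (fun n => by positivity) (hC f)

/-- The sum of the Dirichlet series of `f`. -/
def dirichletSum (f : BergmanSpace p) (s : ℂ) : ℂ := ∑' n : ℕ+, coeff f n * ((n : ℕ) : ℂ) ^ (-s)

lemma tendsto_Icc_one_atTop : Tendsto (fun N : ℕ+ => Finset.Icc 1 N) atTop atTop :=
  tendsto_atTop_finset_of_monotone (fun _ _ h => Finset.Icc_subset_Icc_right h)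
    fun n => ⟨n, Finset.mem_Icc.2 ⟨one_le, le_rfl⟩⟩

lemma rpow_neg_le_rpow_neg (n : ℕ+) {σ τ : ℝ} (h : σ ≤ τ) :
    ((n : ℕ) : ℝ) ^ (-τ) ≤ ((n : ℕ) : ℝ) ^ (-σ) :=
  Real.rpow_le_rpow_of_exponent_le (by exact_mod_cast n.pos) (by linarith)

lemma tendstoUniformlyOn_partialSum (f : BergmanSpace p) {r : ℝ} (hr : 1 / 2 < r) :
    TendstoUniformlyOn (partialSum (coeff f)) (dirichletSum f) atTop {s : ℂ | r < s.re} := by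
  have h := tendstoUniformlyOn_tsum (summable_norm_coeff_mul_rpow hr f)
    (f := fun (n : ℕ+) (s : ℂ) => coeff f n * ((n : ℕ) : ℂ) ^ (-s)) (s := {s : ℂ | r < s.re})
    (fun n s hs => by
      rw [norm_mul_natCast_cpow]
      exact mul_le_mul_of_nonneg_left (rpow_neg_le_rpow_neg n (le_of_lt hs)) (norm_nonneg _))
  exact fun u hu => tendsto_Icc_one_atTop.eventually (h u hu)

lemma tendsto_partialSum (f : BergmanSpace p) {s : ℂ} (hs : 1 / 2 < s.re) :
    Tendsto (fun N => partialSum (coeff f) N s) atTop (𝓝 (dirichletSum f s)) := by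
  obtain ⟨r, h1, h2⟩ := exists_between hs
  exact (tendstoUniformlyOn_partialSum f h1).tendsto_at h2

lemma analyticOnNhd_dirichletSum (f : BergmanSpace p) :
    AnalyticOnNhd ℂ (dirichletSum f) {s : ℂ | 1 / 2 < s.re} := by
  intro s hs
  obtain ⟨r, h1, h2⟩ := exists_between (show 1 / 2 < s.re from hs)
  have hU : IsOpen {s : ℂ | r < s.re} := isOpen_lt continuous_const Complex.continuous_re
  have hd := (tendstoUniformlyOn_partialSum f h1).tendstoLocallyUniformlyOn.differentiableOn
    (Eventually.of_forall fun N => ?_) hU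
  · exact hd.analyticAt (hU.mem_nhds h2)
  · unfold partialSum
    refine DifferentiableOn.fun_sum fun n _ => ?_
    have hn : ((n : ℕ) : ℂ) ≠ 0 := by exact_mod_cast n.ne_zero
    exact ((differentiable_id.neg.const_cpow (Or.inl hn)).const_mul _).differentiableOn

lemma exists_norm_dirichletSum_le {σ : ℝ} (hσ : 1 / 2 < σ) (p : ℝ≥0∞) [Fact (1 ≤ p)] :
    ∃ C : ℝ, 0 ≤ C ∧ ∀ (f : BergmanSpace p) (s : ℂ), σ ≤ s.re → ‖dirichletSum f s‖ ≤ C * ‖f‖ := by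
  obtain ⟨C, h0, hC⟩ := exists_sum_norm_coeff_mul_rpow_le p hσ
  refine ⟨C, h0, fun f s hs => ?_⟩
  refine tsum_of_norm_bounded (summable_norm_coeff_mul_rpow hσ f).hasSum (fun n => ?_) |>.trans ?_
  · rw [norm_mul_natCast_cpow]
    exact mul_le_mul_of_nonneg_left (rpow_neg_le_rpow_neg n hs) (norm_nonneg _)
  · exact Real.tsum_le_of_sum_le (fun n => by positivity) (hC f)

/-- The evaluation of the Dirichlet series at `w`. -/
lemma exists_evaluation (p : ℝ≥0∞) [Fact (1 ≤ p)] {w : ℂ} (hw : 1 / 2 < w.re) :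
    ∃ δ : BergmanSpace p →L[ℂ] ℂ, ∀ f, δ f = dirichletSum f w := by
  obtain ⟨C, -, hC⟩ := exists_norm_dirichletSum_le hw p
  have hs : ∀ f : BergmanSpace p, Summable fun n : ℕ+ => coeff f n * ((n : ℕ) : ℂ) ^ (-w) :=
    fun f => Summable.of_norm ((summable_norm_coeff_mul_rpow hw f).congr fun n =>
      (norm_mul_natCast_cpow _ n w).symm)
  refine ⟨LinearMap.mkContinuous
    { toFun := fun f => dirichletSum f w
      map_add' := fun f g => ?_
      map_smul' := fun c f => ?_ } C fun f => hC f w le_rfl, fun f => rfl⟩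
  · simp only [dirichletSum]
    rw [← (hs f).tsum_add (hs g)]
    refine tsum_congr fun n => ?_
    simp only [coeff, map_add, add_mul]
  · simp only [dirichletSum, RingHom.id_apply, smul_eq_mul]
    rw [← tsum_mul_left]
    refine tsum_congr fun n => ?_
    simp only [coeff, map_smul, smul_eq_mul, mul_assoc]

lemma monomial_natCast_cpow (n : ℕ+) {w : ℂ} (hw : w ≠ 0) :
    monomial n (fun q => ((q : ℕ) : ℂ) ^ (-w)) = ((n : ℕ) : ℂ) ^ (-w) := by
  -- Complete multiplicativity of `k ↦ k ^ (-w)` is what makes evaluation at `w` a point evaluation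
  -- of the lift.
  have h : ∀ k : ℕ, (k : ℂ) ^ (-w) = riemannZetaSummandHom hw k := fun k => rfl
  simp only [monomial, h, ← map_pow, ← map_prod]
  rw [prod_primeSupport_pow subset_rfl]

lemma dirichletSum_coe (P : DirichletPoly p) {w : ℂ} (hw : w ≠ 0) :
    dirichletSum (P : BergmanSpace p) w = lift P fun q => ((q : ℕ) : ℂ) ^ (-w) := by
  rw [dirichletSum, tsum_eq_sum (s := (DirichletPoly.toFinsupp p P).support), lift]
  · refine Finset.sum_congr rfl fun n _ => ?_
    rw [monomial_natCast_cpow n hw, coeff, coeffL_coe]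
  · intro n hn
    have : polyCoeff p n P = 0 := Finsupp.notMem_support_iff.1 hn
    rw [coeff, coeffL_coe, this, zero_mul]

/-! ### The Euler product -/

/-- The real Euler factor `(1 - q ^ (-2σ))⁻¹`. -/
def eulerFactor (σ : ℝ) (q : Nat.Primes) : ℝ := (1 - ((q : ℕ) : ℝ) ^ (-(2 * σ)))⁻¹

lemma natCast_prime_rpow_lt_one {σ : ℝ} (hσ : 1 / 2 < σ) (q : Nat.Primes) :
    ((q : ℕ) : ℝ) ^ (-(2 * σ)) < 1 :=
  Real.rpow_lt_one_of_one_lt_of_neg (by exact_mod_cast q.2.one_lt) (by linarith)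

lemma one_le_eulerFactor {σ : ℝ} (hσ : 1 / 2 < σ) (q : Nat.Primes) : 1 ≤ eulerFactor σ q := by
  have h1 := natCast_prime_rpow_lt_one hσ q
  have h2 : 0 ≤ ((q : ℕ) : ℝ) ^ (-(2 * σ)) := by positivity
  exact (one_le_inv₀ (by linarith)).2 (by linarith)

lemma tendsto_prod_eulerFactor {σ : ℝ} (hσ : 1 / 2 < σ) :
    Tendsto (fun S : Finset Nat.Primes => ∏ q ∈ S, eulerFactor σ q) atTop
      (𝓝 (riemannZeta ((2 * σ : ℝ) : ℂ)).re) := by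
  have h : HasProd (fun q : Nat.Primes => (1 - ((q : ℕ) : ℂ) ^ (-((2 * σ : ℝ) : ℂ)))⁻¹)
      (riemannZeta ((2 * σ : ℝ) : ℂ)) :=
    riemannZeta_eulerProduct_hasProd (by rw [Complex.ofReal_re]; linarith)
  have e : ∀ q : Nat.Primes, (1 - ((q : ℕ) : ℂ) ^ (-((2 * σ : ℝ) : ℂ)))⁻¹ =
      ((eulerFactor σ q : ℝ) : ℂ) := by
    intro q
    rw [eulerFactor, Complex.ofReal_inv, Complex.ofReal_sub, Complex.ofReal_cpow (by positivity)]
    norm_cast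
  simp only [e] at h
  have h' : Tendsto (fun S : Finset Nat.Primes => ∏ q ∈ S, ((eulerFactor σ q : ℝ) : ℂ)) atTop
      (𝓝 (riemannZeta ((2 * σ : ℝ) : ℂ))) := h
  refine ((Complex.continuous_re.tendsto _).comp h').congr fun S => ?_
  rw [Function.comp_apply, ← Complex.ofReal_prod, Complex.ofReal_re]

lemma prod_eulerFactor_le {σ : ℝ} (hσ : 1 / 2 < σ) (S : Finset Nat.Primes) :
    ∏ q ∈ S, eulerFactor σ q ≤ (riemannZeta ((2 * σ : ℝ) : ℂ)).re := by
  refine Monotone.ge_of_tendsto (fun S T hST => ?_) (tendsto_prod_eulerFactor hσ) S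
  exact Finset.prod_le_prod_of_subset_of_one_le hST
    (fun q _ => zero_le_one.trans (one_le_eulerFactor hσ q)) fun q _ _ => one_le_eulerFactor hσ q

lemma prod_one_sub_norm_sq_rpow {w : ℂ} (hw : 1 / 2 < w.re) (S : Finset Nat.Primes) (r : ℝ) :
    ∏ q ∈ S, (1 - ‖((q : ℕ) : ℂ) ^ (-w)‖ ^ 2) ^ (-2 / r) =
      (∏ q ∈ S, eulerFactor w.re q) ^ (2 / r) := by
  rw [← Real.finsetProd_rpow _ _ fun q _ => zero_le_one.trans (one_le_eulerFactor hw q)]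
  refine Finset.prod_congr rfl fun q _ => ?_
  have h1 := natCast_prime_rpow_lt_one hw q
  have h2 : ‖((q : ℕ) : ℂ) ^ (-w)‖ ^ 2 = ((q : ℕ) : ℝ) ^ (-(2 * w.re)) := by
    rw [Complex.norm_natCast_cpow_of_pos q.2.pos, Complex.neg_re,
      ← Real.rpow_mul_natCast (by positivity)]
    congr 1
    push_cast
    ring
  rw [h2, eulerFactor, Real.inv_rpow (by linarith), ← Real.rpow_neg (by linarith), neg_div]

lemma norm_natCast_prime_cpow_lt_one {w : ℂ} (hw : 1 / 2 < w.re) (q : Nat.Primes) :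
    ‖((q : ℕ) : ℂ) ^ (-w)‖ < 1 := by
  rw [Complex.norm_natCast_cpow_of_pos q.2.pos, Complex.neg_re]
  exact Real.rpow_lt_one_of_one_lt_of_neg (by exact_mod_cast q.2.one_lt) (by linarith)

lemma ne_zero_of_half_lt_re {w : ℂ} (hw : 1 / 2 < w.re) : w ≠ 0 := by
  rintro rfl
  norm_num at hw

lemma norm_dirichletSum_le (hp : p ≠ ⊤) {w : ℂ} (hw : 1 / 2 < w.re) (f : BergmanSpace p) :
    ‖dirichletSum f w‖ ≤ (riemannZeta ((2 * w.re : ℝ) : ℂ)).re ^ (2 / p.toReal) * ‖f‖ := by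
  obtain ⟨δ, hδ⟩ := exists_evaluation p hw
  rw [← hδ]
  have hr := one_le_toReal hp
  induction f using Completion.induction_on with
  | hp => exact isClosed_le (by fun_prop) (by fun_prop)
  | ih P =>
    rw [hδ, dirichletSum_coe P (ne_zero_of_half_lt_re hw), Completion.norm_coe]
    refine (norm_lift_le hp P (norm_natCast_prime_cpow_lt_one hw)).trans ?_
    rw [prod_one_sub_norm_sq_rpow hw]
    gcongr
    · exact Finset.prod_nonneg fun q _ => zero_le_one.trans (one_le_eulerFactor hw q)
    · exact prod_eulerFactor_le hw _

lemma zeta_re_nonneg {σ : ℝ} (hσ : 1 / 2 < σ) : 0 ≤ (riemannZeta ((2 * σ : ℝ) : ℂ)).re := by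
  have := prod_eulerFactor_le hσ ∅
  rw [Finset.prod_empty] at this
  linarith

/-- For the lower bound, each finite set of primes gives a partial Euler product below `‖δ‖`; pass
to the limit. -/
lemma exists_evaluation_norm_eq (hp : p ≠ ⊤) {w : ℂ} (hw : 1 / 2 < w.re) :
    ∃ δ : BergmanSpace p →L[ℂ] ℂ, (∀ f, δ f = dirichletSum f w) ∧
      ‖δ‖ = (riemannZeta ((2 * w.re : ℝ) : ℂ)).re ^ (2 / p.toReal) := by
  obtain ⟨δ, hδ⟩ := exists_evaluation p hw
  have hr := one_le_toReal hp
  refine ⟨δ, hδ, le_antisymm ?_ ?_⟩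
  · refine δ.opNorm_le_bound (Real.rpow_nonneg (zeta_re_nonneg hw) _) fun f => ?_
    rw [hδ]
    exact norm_dirichletSum_le hp hw f
  · refine le_of_tendsto' ((tendsto_prod_eulerFactor hw).rpow_const (Or.inr (by positivity)))
      fun S => ?_
    rw [← prod_one_sub_norm_sq_rpow hw]
    refine prod_le_of_norm_lift_le hp (norm_natCast_prime_cpow_lt_one hw) (fun P => ?_) S
    rw [← dirichletSum_coe P (ne_zero_of_half_lt_re hw), ← hδ, ← Completion.norm_coe P]
    exact δ.le_opNorm _

/-! ### The abscissas -/

lemma sInf_toEReal_image_le {A : Set ℝ} {a : ℝ} (h : ∀ r, a < r → r ∈ A) :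
    sInf (Real.toEReal '' A) ≤ (a : EReal) := by
  refine EReal.le_of_forall_lt_iff_le.1 fun r hr => ?_
  exact sInf_le ⟨r, h r (EReal.coe_lt_coe_iff.1 hr), rfl⟩

lemma abscissaUnif_coeff_le (f : BergmanSpace p) :
    abscissaUnif (coeff f) ≤ ((1 / 2 : ℝ) : EReal) :=
  sInf_toEReal_image_le fun _ hr => ⟨dirichletSum f, tendstoUniformlyOn_partialSum f hr⟩

lemma abscissaBdd_coeff_le (f : BergmanSpace p) :
    abscissaBdd (coeff f) ≤ ((1 / 2 : ℝ) : EReal) := by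
  refine sInf_toEReal_image_le fun r hr => ⟨dirichletSum f, ?_, ?_, r, fun s hs => ?_⟩
  · exact (analyticOnNhd_dirichletSum f).mono fun s hs => hr.trans hs
  · obtain ⟨C, -, hC⟩ := exists_norm_dirichletSum_le hr p
    exact ⟨C * ‖f‖, fun s hs => hC f s hs.le⟩
  · exact tendsto_partialSum f (hr.trans hs)

/-- The bounded extension lives on a half-plane containing `Re s > 1/2`. Both functions are limits
of the same partial sums far to the right, so the identity theorem makes them agree there. -/
lemma exists_bound_of_abscissaBdd_lt {f : BergmanSpace p}
    (h : abscissaBdd (coeff f) < ((1 / 2 : ℝ) : EReal)) :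
    ∃ M : ℝ, ∀ s : ℂ, 1 / 2 < s.re → ‖dirichletSum f s‖ ≤ M := by
  obtain ⟨_, ⟨r, ⟨F, hF, ⟨M, hM⟩, c, hc⟩, rfl⟩, hr⟩ := sInf_lt_iff.1 h
  have hr' : r < 1 / 2 := EReal.coe_lt_coe_iff.1 hr
  refine ⟨M, fun s hs => ?_⟩
  have heq : Set.EqOn F (dirichletSum f) {s : ℂ | 1 / 2 < s.re} := by
    have hpre : IsPreconnected {s : ℂ | 1 / 2 < s.re} :=
      (convex_halfSpace_re_gt (1 / 2)).isPreconnected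
    have hz : 1 / 2 < (((max c (1 / 2) + 1 : ℝ)) : ℂ).re := by
      rw [Complex.ofReal_re]
      linarith [le_max_right c (1 / 2)]
    refine (hF.mono fun s hs => hr'.trans hs).eqOn_of_preconnected_of_eventuallyEq
      (analyticOnNhd_dirichletSum f) hpre hz ?_
    have hopen : IsOpen {s : ℂ | max c (1 / 2) < s.re} :=
      isOpen_lt continuous_const Complex.continuous_re
    filter_upwards [hopen.mem_nhds (show max c (1 / 2) < (((max c (1 / 2) + 1 : ℝ)) : ℂ).re by
      rw [Complex.ofReal_re]; linarith)] with s hs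
    exact tendsto_nhds_unique (hc s ((le_max_left _ _).trans_lt hs))
      (tendsto_partialSum f ((le_max_right _ _).trans_lt hs))
  rw [← heq hs]
  exact hM s (hr'.trans hs)

/-- The values of the zeta function at `1 + 2 / (n + 1)` are unbounded. -/
lemma not_zeta_rpow_le {a : ℝ} (ha : 0 < a) (C : ℝ) :
    ¬ ∀ n : ℕ, (riemannZeta ((2 * (1 / 2 + 1 / ((n : ℝ) + 1)) : ℝ) : ℂ)).re ^ a ≤ C := by
  intro h
  set Z : ℕ → ℝ := fun n => (riemannZeta ((2 * (1 / 2 + 1 / ((n : ℝ) + 1)) : ℝ) : ℂ)).re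
  have hZ0 : ∀ n, 0 ≤ Z n := fun n => zeta_re_nonneg (by
    have : 0 < 1 / ((n : ℝ) + 1) := by positivity
    linarith)
  have hZ : ∀ n, Z n ≤ C ^ (1 / a) := fun n => by
    have := Real.rpow_le_rpow (Real.rpow_nonneg (hZ0 n) a) (h n) (one_div_pos.2 ha).le
    rwa [← Real.rpow_mul (hZ0 n), mul_one_div_cancel ha.ne', Real.rpow_one] at this
  have hlim : Tendsto (fun n : ℕ => 1 / ((n : ℝ) + 1)) atTop (𝓝 0) :=
    tendsto_one_div_add_atTop_nhds_zero_nat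
  have hs : Tendsto (fun n : ℕ => ((2 * (1 / 2 + 1 / ((n : ℝ) + 1)) : ℝ) : ℂ)) atTop
      (𝓝[≠] 1) := by
    refine tendsto_nhdsWithin_iff.2 ⟨?_, Eventually.of_forall fun n => ?_⟩
    · have := (hlim.const_add (1 / 2)).const_mul 2
      norm_num at this
      have h2 := (Complex.continuous_ofReal.tendsto 1).comp (by simpa using this)
      simpa [Function.comp_def] using h2
    · have : (0 : ℝ) < 1 / ((n : ℝ) + 1) := by positivity
      simp only [Set.mem_compl_iff, Set.mem_singleton_iff]
      intro hc
      have : (2 * (1 / 2 + 1 / ((n : ℝ) + 1)) : ℝ) = 1 := by exact_mod_cast hc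
      linarith
  -- Along these points `(s - 1) ζ(s)` tends to the residue `1`, whereas bounded zeta values would
  -- make the limit at most `0`.
  have h1 := (Complex.continuous_re.tendsto _).comp (riemannZeta_residue_one.comp hs)
  have h2 : ∀ n : ℕ, (Complex.re ∘ (fun s => (s - 1) * riemannZeta s) ∘ fun n : ℕ =>
      ((2 * (1 / 2 + 1 / ((n : ℝ) + 1)) : ℝ) : ℂ)) n = 2 * (1 / ((n : ℝ) + 1)) * Z n := by
    intro n
    simp only [Function.comp_apply, Z]
    rw [← Complex.ofReal_one, ← Complex.ofReal_sub, Complex.re_ofReal_mul]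
    congr 1
    ring
  have h3 : Tendsto (fun n : ℕ => 2 * (1 / ((n : ℝ) + 1)) * C ^ (1 / a)) atTop (𝓝 0) := by
    simpa using (hlim.const_mul 2).mul_const (C ^ (1 / a))
  have h4 := le_of_tendsto_of_tendsto' h1 h3 fun n => by
    rw [h2]
    exact mul_le_mul_of_nonneg_left (hZ n) (by positivity)
  norm_num at h4

/-- Otherwise every `f` would be bounded on `Re s > 1/2`. Banach–Steinhaus would then bound the
norms of the evaluations at `1/2 + 1/(n + 1)`, that is, the powers of zeta near its pole. -/
lemma exists_abscissaBdd_eq (hp : p ≠ ⊤) :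
    ∃ f : BergmanSpace p, abscissaBdd (coeff f) = ((1 / 2 : ℝ) : EReal) := by
  by_contra! hne
  have hr := one_le_toReal hp
  have hw : ∀ n : ℕ, 1 / 2 < (((1 / 2 + 1 / ((n : ℝ) + 1) : ℝ)) : ℂ).re := fun n => by
    have : 0 < 1 / ((n : ℝ) + 1) := by positivity
    rw [Complex.ofReal_re]
    linarith
  choose δ hδ hnorm using fun n => exists_evaluation_norm_eq hp (hw n)
  obtain ⟨C, hC⟩ := banach_steinhaus (g := δ) fun f => by
    obtain ⟨M, hM⟩ := exists_bound_of_abscissaBdd_lt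
      (lt_of_le_of_ne (abscissaBdd_coeff_le f) (hne f))
    exact ⟨M, fun n => by rw [hδ]; exact hM _ (hw n)⟩
  refine not_zeta_rpow_le (a := 2 / p.toReal) (by positivity) C fun n => ?_
  have := hC n
  rw [hnorm, Complex.ofReal_re] at this
  exact this

end DirichletBergman

end

theorem mainTheorem3 (p : ENNReal) [Fact (1 ≤ p)] (hp : p ≠ ⊤) :
    (∀ f : DirichletBergman.BergmanSpace p,
      DirichletBergman.abscissaUnif (DirichletBergman.coeff f) ≤ ((1 / 2 : ℝ) : EReal)) ∧
    (∀ w : ℂ, 1 / 2 < w.re →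
      ∃ δ : DirichletBergman.BergmanSpace p →L[ℂ] ℂ,
        (∀ f : DirichletBergman.BergmanSpace p,
          Filter.Tendsto
            (fun N : ℕ+ => DirichletBergman.partialSum (DirichletBergman.coeff f) N w)
            Filter.atTop (nhds (δ f))) ∧
        (∀ f : DirichletBergman.BergmanSpace p,
          ‖δ f‖ ≤ (riemannZeta ((2 * w.re : ℝ) : ℂ)).re ^ (2 / p.toReal) * ‖f‖) ∧
        ‖δ‖ = (riemannZeta ((2 * w.re : ℝ) : ℂ)).re ^ (2 / p.toReal)) ∧
    (∃ f : DirichletBergman.BergmanSpace p,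
      DirichletBergman.abscissaBdd (DirichletBergman.coeff f) = ((1 / 2 : ℝ) : EReal)) := by
  refine ⟨DirichletBergman.abscissaUnif_coeff_le, fun w hw => ?_,
    DirichletBergman.exists_abscissaBdd_eq hp⟩
  obtain ⟨δ, hδ, hnorm⟩ := DirichletBergman.exists_evaluation_norm_eq hp hw
  refine ⟨δ, fun f => ?_, fun f => ?_, hnorm⟩
  · rw [hδ]
    exact DirichletBergman.tendsto_partialSum f hw
  · rw [hδ]
    exact DirichletBergman.norm_dirichletSum_le hp hw f
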